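/- Let $d\ge 1$ and let $A:\mathbb R^d\to\mathbb R^d$ be an expansive dilation, i.e. a linear map with $A(\mathbb Z^d)\subseteq\mathbb Z^d$ all of whose complex eigenvalues have modulus $>1$; let $A^*$ be its adjoint, $d_A=|\det A|$, and $\mathcal D_Af(x)=d_A^{1/2}f(Ax)$ for $f\in L^2(\mathbb R^d)$. Let $V\subseteq L^2(\mathbb R^d)$ be a shift-invariant subspace (a closed subspace with $f(\cdot-k)\in V$ for all $f\in V$, $k\in\mathbb Z^d$) that is $A$-refinable, i.e. $V\subseteq\mathcal D_AV$. A family $\{\phi^\alpha\}_{\alpha\in I}\subseteq V$ is a tight frame generator of $V$ if $\sum_{\alpha\in I}\sum_{k\in\mathbb Z^d}|\langle f,\phi^\alpha(\cdot-k)\rangle|^2=\|f\|^2$ for all $f\in V$. The spectral function of $V$ is $\sigma_V(\xi)=\sum_{\alpha\in I}|\widehat{\phi^\alpha}(\xi)|^2$ (a.e.), where $\{\phi^\alpha\}$ is a tight frame generator of $V$ and $\widehat f(\xi)=\int f(x)e^{-2\pi i x\cdot\xi}\,dx$. Write $\mathrm{Supp}(f)=\{x: f(x)\ne0\}$, $B_r$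 for the open ball of radius $r$ about $0$, and $|\cdot|$ for Lebesgue measure; equalities of sets are up to null sets. A set $\mathcal G$ generates $V$ if the linear span of the integer translates of elements of $\mathcal G$ is a dense subspace of $V$. Then $\sigma_V$ exists (the sum converges a.e. for some tight frame generator), and for every such $\sigma_V$ the following conditions are equivalent: 1. $\overline{\bigcup_{j\in\mathbb Z}\mathcal D_A^jV}=L^2(\mathbb R^d)$; 2. $\bigcup_{\phi\in\mathcal G}\bigcup_{j\in\mathbb Z}A^{*j}(\mathrm{Supp}(\widehat\phi))=\mathbb R^d$ for every $\mathcal G$ that generates $V$ (equivalently, for some countable $\mathcal G$ that generates $V$); 3. for every bounded measurable set $E\subseteq\mathbb R^d$ of positive measure, $\lim_{j\to\infty}\frac1{|A^{*-j}E|}\int_{A^{*-j}E}\sigma_V(\xi)\,d\xi=1$; 4. $\mathrm{Supp}(\sigma_V)$ is $A^{*-1}$-absorbing: for a.e. $\xi\in\mathbb R^d$ there is $j_0$ with $A^{*-j}\xi\in\mathrm{Supp}(\sigma_V)$ for all $j\ge j_0$; 5. for a.e. $\xi\in\mathbb R^d$ the limit $\lim_{j\to\infty}\sigma_V(A^{*-j}\xi)$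 exists and is $>0$; 6. $\lim_{j\to\infty}\sigma_V(A^{*-j}\xi)=1$ for a.e. $\xi\in\mathbb R^d$; 7. $\sigma_V$ is $A^*$-locally nonzero at the origin: $\lim_{j\to\infty}\frac{|\{x\in A^{*-j}B_1:\ \sigma_V(x)=0\}|}{|A^{*-j}B_1|}=0$; 8. the origin is a point of $A^*$-approximate continuity of $\sigma_V$ if we put $\sigma_V(0)=1$: there is a measurable set $E$ of positive measure such that $\lim_{j\to\infty}\frac{|E\cap A^{*-j}B_r|}{|A^{*-j}B_r|}=1$ for all $r>0$, and $\lim_{x\to0,\,x\in E}\sigma_V(x)=1$. -/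

import Mathlib

open MeasureTheory Filter Topology
open scoped FourierTransform ENNReal

noncomputable section

namespace SpectralCompleteness

/-- The space `ℝᵈ` with its Euclidean structure and Lebesgue measure. -/
abbrev Rd (d : ℕ) : Type := EuclideanSpace ℝ (Fin d)

/-- The Hilbert space `L²(ℝᵈ)` of complex-valued functions. Its Fourier transform `𝓕` is Mathlib's,
the unitary extension of `f ↦ ∫ f(x) e^{-2πi x·ξ} dx`. -/
abbrev L2 (d : ℕ) : Type := Lp (α := Rd d) ℂ 2 volume

variable {d : ℕ}

/-- The point of `ℝᵈ` with integer coordinates `k`. -/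
def latticePoint (k : Fin d → ℤ) : Rd d := WithLp.toLp 2 (fun i => (k i : ℝ))

/-! ### Expansive dilations -/

/-- A linear map `A` of `ℝᵈ` with `A(ℤᵈ) ⊆ ℤᵈ`, all of whose complex eigenvalues have modulus
greater than one. -/
structure IsExpansiveDilation (A : Rd d →ₗ[ℝ] Rd d) : Prop where
  map_lattice : ∀ k : Fin d → ℤ, ∃ m : Fin d → ℤ, A (latticePoint k) = latticePoint m
  one_lt_norm : ∀ z : ℂ, Module.End.HasEigenvalue (A.baseChange ℂ) z → 1 < ‖z‖

theorem IsExpansiveDilation.injective {A : Rd d →ₗ[ℝ] Rd d} (hA : IsExpansiveDilation A) :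
    Function.Injective A := by
  rw [← LinearMap.ker_eq_bot, LinearMap.ker_eq_bot']
  intro x hx
  by_contra hne
  have h : Module.End.HasEigenvalue (A.baseChange ℂ) 0 := by
    refine Module.End.hasEigenvalue_of_hasEigenvector (x := (1 : ℂ) ⊗ₜ[ℝ] x) ⟨?_, ?_⟩
    · rw [Module.End.mem_eigenspace_iff]
      simp [hx]
    · intro h0
      apply hne
      exact (Module.Flat.tensorProduct_mk_injective (R := ℝ) (S := ℂ) (Rd d)) (by simpa using h0)
  have := hA.one_lt_norm 0 h
  simp at this
  linarith

theorem IsExpansiveDilation.adjoint_injective {A : Rd d →ₗ[ℝ] Rd d} (hA : IsExpansiveDilation A) :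
    Function.Injective (LinearMap.adjoint A) := by
  rw [← LinearMap.ker_eq_bot, LinearMap.ker_eq_bot']
  intro x hx
  obtain ⟨y, rfl⟩ := LinearMap.injective_iff_surjective.mp hA.injective x
  have h : inner ℝ (LinearMap.adjoint A (A y)) y = 0 := by rw [hx, inner_zero_left]
  rw [LinearMap.adjoint_inner_left] at h
  exact inner_self_eq_zero.mp h

/-- An expansive dilation as an invertible linear map, so that `A^j` makes sense for `j ∈ ℤ`. -/
def IsExpansiveDilation.equiv {A : Rd d →ₗ[ℝ] Rd d} (hA : IsExpansiveDilation A) :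
    Rd d ≃ₗ[ℝ] Rd d :=
  LinearEquiv.ofInjectiveEndo A hA.injective

/-- The adjoint `A*` of an expansive dilation as an invertible linear map. -/
def IsExpansiveDilation.adjointEquiv {A : Rd d →ₗ[ℝ] Rd d} (hA : IsExpansiveDilation A) :
    Rd d ≃ₗ[ℝ] Rd d :=
  LinearEquiv.ofInjectiveEndo (LinearMap.adjoint A) hA.adjoint_injective

/-! ### Translations and dilations on `L²(ℝᵈ)` -/

/-- The translation `f ↦ f(· - k)`, for `k ∈ ℤᵈ`. -/
def shift (k : Fin d → ℤ) : L2 d →ₗᵢ[ℂ] L2 d :=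
  Lp.compMeasurePreservingₗᵢ ℂ (fun x : Rd d => x - latticePoint k)
    (measurePreserving_sub_right volume (latticePoint k))

theorem quasiMeasurePreserving_equiv (B : Rd d ≃ₗ[ℝ] Rd d) :
    Measure.QuasiMeasurePreserving B (volume : Measure (Rd d)) volume := by
  have hB : Measurable B := B.toContinuousLinearEquiv.continuous.measurable
  refine ⟨hB, ?_⟩
  have h : Measure.map B (volume : Measure (Rd d)) = _ :=
    Measure.map_linearMap_addHaar_eq_smul_addHaar volume (f := (B : Rd d →ₗ[ℝ] Rd d))
      B.isUnit_det'.ne_zero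
  rw [h]
  exact Measure.smul_absolutelyContinuous

theorem memLp_comp_equiv (B : Rd d ≃ₗ[ℝ] Rd d) (f : L2 d) :
    MemLp (fun x => f (B x)) 2 (volume : Measure (Rd d)) := by
  have hB : Measurable B := B.toContinuousLinearEquiv.continuous.measurable
  have h : Measure.map B (volume : Measure (Rd d)) = _ :=
    Measure.map_linearMap_addHaar_eq_smul_addHaar volume (f := (B : Rd d →ₗ[ℝ] Rd d))
      B.isUnit_det'.ne_zero
  have h2 : MemLp f 2 (Measure.map B (volume : Measure (Rd d))) := by
    rw [h]
    exact (Lp.memLp f).smul_measure ENNReal.ofReal_ne_top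
  exact h2.comp_of_map hB.aemeasurable

/-- The value at `f` of the dilation operator: the class of `x ↦ |det B|^{1/2} f(B x)`. -/
def dilationFun (B : Rd d ≃ₗ[ℝ] Rd d) (f : L2 d) : L2 d :=
  (((memLp_comp_equiv B f).const_mul
    ((Real.sqrt |LinearMap.det (B : Rd d →ₗ[ℝ] Rd d)| : ℝ) : ℂ))).toLp _

theorem coeFn_dilationFun (B : Rd d ≃ₗ[ℝ] Rd d) (f : L2 d) :
    dilationFun B f =ᵐ[volume]
      fun x => ((Real.sqrt |LinearMap.det (B : Rd d →ₗ[ℝ] Rd d)| : ℝ) : ℂ) * f (B x) :=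
  MemLp.coeFn_toLp _

theorem dilationFun_dilationFun (B C : Rd d ≃ₗ[ℝ] Rd d) (hCB : ∀ x, C (B x) = x) (f : L2 d) :
    dilationFun B (dilationFun C f) = f := by
  apply Lp.ext
  filter_upwards [coeFn_dilationFun B (dilationFun C f),
    (quasiMeasurePreserving_equiv B).ae (coeFn_dilationFun C f)] with x h1 h2
  rw [h1, h2, hCB, ← mul_assoc, ← Complex.ofReal_mul, ← Real.sqrt_mul (abs_nonneg _), ← abs_mul,
    ← LinearMap.det_comp]
  have : (B : Rd d →ₗ[ℝ] Rd d) ∘ₗ (C : Rd d →ₗ[ℝ] Rd d) = LinearMap.id := by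
    ext1 x
    apply C.injective
    simp [hCB]
  rw [this]
  simp

/-- The dilation operator `𝒟_B f(x) = |det B|^{1/2} f(B x)` on `L²(ℝᵈ)`, as an invertible linear
operator; `dilation B ^ j` is its `j`-th power, `j ∈ ℤ`. -/
def dilation (B : Rd d ≃ₗ[ℝ] Rd d) : L2 d ≃ₗ[ℂ] L2 d where
  toFun := dilationFun B
  invFun := dilationFun B.symm
  map_add' f g := by
    apply Lp.ext
    filter_upwards [coeFn_dilationFun B (f + g), coeFn_dilationFun B f, coeFn_dilationFun B g,
      Lp.coeFn_add (dilationFun B f) (dilationFun B g),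
      (quasiMeasurePreserving_equiv B).ae (Lp.coeFn_add f g)] with x h1 h2 h3 h4 h5
    rw [h1, h4, Pi.add_apply, h2, h3, h5, Pi.add_apply, mul_add]
  map_smul' c f := by
    apply Lp.ext
    filter_upwards [coeFn_dilationFun B (c • f), coeFn_dilationFun B f,
      Lp.coeFn_smul c (dilationFun B f),
      (quasiMeasurePreserving_equiv B).ae (Lp.coeFn_smul c f)] with x h1 h2 h3 h4
    simp only [RingHom.id_apply]
    rw [h1, h3, Pi.smul_apply, h2, h4, Pi.smul_apply, smul_eq_mul, smul_eq_mul]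
    ring
  left_inv f := dilationFun_dilationFun B.symm B (fun x => B.apply_symm_apply x) f
  right_inv f := dilationFun_dilationFun B B.symm (fun x => B.symm_apply_apply x) f

/-! ### Shift-invariant subspaces -/

/-- A closed subspace of `L²(ℝᵈ)` that is invariant under all integer translations. -/
structure IsShiftInvariant (V : Submodule ℂ (L2 d)) : Prop where
  isClosed : IsClosed (V : Set (L2 d))
  shift_mem : ∀ f ∈ V, ∀ k : Fin d → ℤ, shift k f ∈ V

/-- `V ⊆ 𝒟_B V`. -/
def IsRefinable (B : Rd d ≃ₗ[ℝ] Rd d) (V : Submodule ℂ (L2 d)) : Prop :=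
  V ≤ V.map (dilation B).toLinearMap

/-- The completeness property: `⋃_{j ∈ ℤ} 𝒟_B^j V` is dense in `L²(ℝᵈ)`. -/
def HasCompletenessProperty (B : Rd d ≃ₗ[ℝ] Rd d) (V : Submodule ℂ (L2 d)) : Prop :=
  closure (⋃ j : ℤ, (dilation B ^ j) '' (V : Set (L2 d))) = Set.univ

/-- The closed linear span of the integer translates of the elements of `𝒢` is `V`. -/
def Generates (𝒢 : Set (L2 d)) (V : Submodule ℂ (L2 d)) : Prop :=
  (Submodule.span ℂ {f | ∃ φ ∈ 𝒢, ∃ k : Fin d → ℤ, f = shift k φ}).topologicalClosure = V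

/-- The family `φ` lies in `V` and
`∑_{i} ∑_{k ∈ ℤᵈ} |⟨f, φ_i(· - k)⟩|² = ‖f‖²` for every `f ∈ V`. -/
def IsTightFrameGenerator {ι : Type} (φ : ι → L2 d) (V : Submodule ℂ (L2 d)) : Prop :=
  (∀ i, φ i ∈ V) ∧
    ∀ f ∈ V, HasSum (fun p : ι × (Fin d → ℤ) => ‖inner ℂ f (shift p.2 (φ p.1))‖ ^ 2) (‖f‖ ^ 2)

/-- `σ` is (a representative, up to null sets, of) the spectral function of `V`:
`σ = ∑_{i} |φ̂_i|²` almost everywhere, for some tight frame generator `φ` of `V`. -/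
def IsSpectralFunction (V : Submodule ℂ (L2 d)) (σ : Rd d → ℝ) : Prop :=
  ∃ (ι : Type) (φ : ι → L2 d), IsTightFrameGenerator φ V ∧
    ∀ᵐ ξ : Rd d, HasSum (fun i => ‖(𝓕 (φ i) : L2 d) ξ‖ ^ 2) (σ ξ)

/-! ### Local behaviour at the origin -/

/-- The union of the sets `B^j(Supp φ̂)`, for `φ ∈ 𝒢` and `j ∈ ℤ`. -/
def dilatedFourierSupports (B : Rd d ≃ₗ[ℝ] Rd d) (𝒢 : Set (L2 d)) : Set (Rd d) :=
  ⋃ φ ∈ 𝒢, ⋃ j : ℤ, (B ^ j) '' Function.support (𝓕 φ : L2 d)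

/-- The origin is a point of `B`-density for `S`. -/
def IsPointOfDensity (B : Rd d ≃ₗ[ℝ] Rd d) (S : Set (Rd d)) : Prop :=
  ∀ r : ℝ, 0 < r → Tendsto (fun j : ℕ =>
    volume.real (S ∩ (B ^ (-(j : ℤ))) '' Metric.ball 0 r) /
      volume.real ((B ^ (-(j : ℤ))) '' Metric.ball (0 : Rd d) r)) atTop (𝓝 1)

/-- The origin is a point of `B`-approximate continuity of `f`. -/
def IsApproxContinuous (B : Rd d ≃ₗ[ℝ] Rd d) (f : Rd d → ℝ) : Prop :=
  ∃ S : Set (Rd d), MeasurableSet S ∧ 0 < volume S ∧ IsPointOfDensity B S ∧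
    Tendsto f (𝓝[S] 0) (𝓝 (f 0))

/-- `f` is `B`-locally nonzero at the origin. -/
def IsLocallyNonzero (B : Rd d ≃ₗ[ℝ] Rd d) (f : Rd d → ℝ) : Prop :=
  Tendsto (fun j : ℕ =>
    volume.real {x ∈ (B ^ (-(j : ℤ))) '' Metric.ball (0 : Rd d) 1 | f x = 0} /
      volume.real ((B ^ (-(j : ℤ))) '' Metric.ball (0 : Rd d) 1)) atTop (𝓝 0)

/-- `S` is `B`-absorbing in `ℝᵈ`: for almost every `ξ` one has `B^j ξ ∈ S` for all large `j`. -/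
def IsAbsorbing (B : Rd d ≃ₗ[ℝ] Rd d) (S : Set (Rd d)) : Prop :=
  ∀ᵐ ξ : Rd d, ∃ j₀ : ℕ, ∀ j : ℕ, j₀ ≤ j → (B ^ j) ξ ∈ S

end SpectralCompleteness

end

noncomputable section

namespace SpectralCompleteness

variable {d : ℕ}

/-! ### Dilations are unitary and multiplicative -/

/-! Let P be the orthogonal projection onto V, and for a measurable set E let p_E be the function
whose Fourier transform is the indicator of E. If E lies in a unit box, Parseval on the torus turns
the frame coefficients of p_E into Fourier coefficients, and the frame identity for P p_E becomes
∫_E σ = ‖P p_E‖² (`IsSpectralFunction.setLIntegral_eq`). This frees σ from the choice of generator.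
All that is needed about σ then follows by testing packets on small sets: 0 ≤ σ ≤ 1 because P is a
contraction, and σ(ξ) ≤ σ(A*⁻¹ξ) because refinability makes the distance to V decrease under 𝒟⁻¹.
Hence σ is monotone and bounded along almost every orbit.

A dilated packet is a multiple of another packet, so for bounded E and large j the mean of σ over
A*⁻ʲE is ‖P 𝒟⁻ʲ p_E‖² / |E|, which is 1 - dist(p_E, 𝒟ʲV)² / |E|. Completeness sends this to 1. If
the orbit limit of σ were below 1 on a set of positive measure, the means over a bounded part of
that set would stay below 1; so σ tends to 1 along almost every orbit, and its support is absorbing.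
Where all generators have vanishing Fourier transform, packets are orthogonal to V and σ vanishes;
so orbits that meet the support of σ meet the support of a generator.

To return to completeness, let f be orthogonal to every 𝒟ʲV. These nested spaces are invariant under
translation by A⁻ʲℤᵈ, and the lattices of large j fill a dense set. For g in some 𝒟ʲV the integrable
product of ĝ and the conjugate of f̂ therefore has a Fourier transform that is zero on a dense set,
hence everywhere (`IsExpansiveDilation.ae_inner_fourier_eq_zero`). If the dilated supports cover
almost everything, f = 0.

For the conditions at the origin, orbit convergence gives convergence in measure on balls, and a
diagonal choice of radii (`IsExpansiveDilation.exists_radii`) produces one set of density 1 along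
which σ tends to 1. Conversely, approximate continuity makes the zeros of σ negligible near 0, so
almost every orbit meets the support. -/

theorem enorm_sq_eq_lintegral (f : L2 d) : ‖f‖ₑ ^ 2 = ∫⁻ x, ‖f x‖ₑ ^ 2 := by
  rw [Lp.enorm_def, eLpNorm_eq_lintegral_rpow_enorm_toReal (by simp) (by simp)]
  simp only [ENNReal.toReal_ofNat, ENNReal.rpow_ofNat]
  rw [← ENNReal.rpow_natCast, ← ENNReal.rpow_mul]
  simp

theorem lintegral_comp_equiv (B : Rd d ≃ₗ[ℝ] Rd d) (f : Rd d → ℝ≥0∞) :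
    ENNReal.ofReal |LinearMap.det (B : Rd d →ₗ[ℝ] Rd d)| * ∫⁻ x, f (B x) = ∫⁻ x, f x := by
  have h : Measure.map B (volume : Measure (Rd d)) = _ :=
    Measure.map_linearMap_addHaar_eq_smul_addHaar volume (f := (B : Rd d →ₗ[ℝ] Rd d))
      B.isUnit_det'.ne_zero
  have hm : MeasurableEmbedding B :=
    B.toContinuousLinearEquiv.toHomeomorph.measurableEmbedding
  have h2 := hm.lintegral_map (μ := (volume : Measure (Rd d))) f
  rw [← h2, h, lintegral_smul_measure, smul_eq_mul, ← mul_assoc,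
    ← ENNReal.ofReal_mul (abs_nonneg _), ← abs_mul, mul_inv_cancel₀ B.isUnit_det'.ne_zero]
  simp

theorem enorm_dilation (B : Rd d ≃ₗ[ℝ] Rd d) (f : L2 d) : ‖dilation B f‖ₑ = ‖f‖ₑ := by
  have h : ‖dilation B f‖ₑ ^ 2 = ‖f‖ₑ ^ 2 := by
    rw [enorm_sq_eq_lintegral, enorm_sq_eq_lintegral, ← lintegral_comp_equiv B fun x => ‖f x‖ₑ ^ 2,
      ← lintegral_const_mul' _ _ ENNReal.ofReal_ne_top]
    apply lintegral_congr_ae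
    filter_upwards [coeFn_dilationFun B f] with x hx
    change ‖dilationFun B f x‖ₑ ^ 2 = _
    rw [hx, enorm_mul, mul_pow]
    congr 1
    rw [← ofReal_norm, Complex.norm_real, Real.norm_of_nonneg (Real.sqrt_nonneg _),
      ← ENNReal.ofReal_pow (Real.sqrt_nonneg _), Real.sq_sqrt (abs_nonneg _)]
  exact (ENNReal.pow_right_strictMono two_ne_zero).injective h

theorem norm_dilation (B : Rd d ≃ₗ[ℝ] Rd d) (f : L2 d) : ‖dilation B f‖ = ‖f‖ := by
  have := congrArg ENNReal.toReal (enorm_dilation B f)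
  simpa using this

theorem continuous_dilation (B : Rd d ≃ₗ[ℝ] Rd d) : Continuous (dilation B) :=
  (LinearIsometry.mk (dilation B).toLinearMap (norm_dilation B)).continuous

theorem dilation_mul (B C : Rd d ≃ₗ[ℝ] Rd d) : dilation (C * B) = dilation B * dilation C := by
  ext1 f
  apply Lp.ext
  change dilationFun (C * B) f =ᵐ[volume] dilationFun B (dilationFun C f)
  filter_upwards [coeFn_dilationFun (C * B) f, coeFn_dilationFun B (dilationFun C f),
    (quasiMeasurePreserving_equiv B).ae (coeFn_dilationFun C f)] with x h1 h2 h3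
  rw [h1, h2, h3, ← mul_assoc, ← Complex.ofReal_mul, ← Real.sqrt_mul (abs_nonneg _), ← abs_mul]
  have : LinearMap.det ((C * B : Rd d ≃ₗ[ℝ] Rd d) : Rd d →ₗ[ℝ] Rd d)
      = LinearMap.det (B : Rd d →ₗ[ℝ] Rd d) * LinearMap.det (C : Rd d →ₗ[ℝ] Rd d) := by
    rw [mul_comm, ← LinearMap.det_comp]
    rfl
  rw [this]
  rfl

/-- `B ↦ 𝒟_B` reverses products. -/
def dilationHom (d : ℕ) : (Rd d ≃ₗ[ℝ] Rd d)ᵐᵒᵖ →* (L2 d ≃ₗ[ℂ] L2 d) :=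
  MonoidHom.mk' (fun B => dilation B.unop) fun B C => dilation_mul B.unop C.unop

theorem dilation_zpow (B : Rd d ≃ₗ[ℝ] Rd d) (j : ℤ) : dilation (B ^ j) = dilation B ^ j :=
  map_zpow (dilationHom d) (MulOpposite.op B) j

/-! ### Fourier transforms of translates and dilates -/

theorem memLp_modulation (y : Rd d) (f : L2 d) :
    MemLp (fun ξ => (𝐞 (-(inner ℝ y ξ)) : ℂ) * f ξ) 2 (volume : Measure (Rd d)) := by
  refine (Lp.memLp f).of_le (by fun_prop) (Eventually.of_forall fun ξ => ?_)
  rw [norm_mul, Circle.norm_coe, one_mul]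

/-- Multiplication by the character `ξ ↦ e^{-2πi y·ξ}`. -/
def modulation (y : Rd d) : L2 d →ₗᵢ[ℂ] L2 d where
  toFun f := (memLp_modulation y f).toLp
  map_add' f g := by
    apply Lp.ext
    filter_upwards [Lp.coeFn_add f g, Lp.coeFn_add (memLp_modulation y f).toLp
      (memLp_modulation y g).toLp, (memLp_modulation y f).coeFn_toLp,
      (memLp_modulation y g).coeFn_toLp, (memLp_modulation y (f + g)).coeFn_toLp]
      with x h1 h2 h3 h4 h5
    rw [h5, h2, Pi.add_apply, h3, h4, h1, Pi.add_apply, mul_add]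
  map_smul' c f := by
    apply Lp.ext
    filter_upwards [Lp.coeFn_smul c f, Lp.coeFn_smul c (memLp_modulation y f).toLp,
      (memLp_modulation y f).coeFn_toLp, (memLp_modulation y (c • f)).coeFn_toLp] with x h1 h2 h3 h4
    rw [h4, RingHom.id_apply, h2, Pi.smul_apply, h3, h1, Pi.smul_apply, smul_eq_mul, smul_eq_mul]
    ring
  norm_map' f := by
    change ‖(memLp_modulation y f).toLp‖ = ‖f‖
    rw [Lp.norm_toLp, Lp.norm_def]
    congr 1
    apply eLpNorm_congr_norm_ae
    refine Eventually.of_forall fun ξ => ?_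
    rw [norm_mul, Circle.norm_coe, one_mul]

theorem coeFn_modulation (y : Rd d) (f : L2 d) :
    modulation y f =ᵐ[volume] fun ξ => (𝐞 (-(inner ℝ y ξ)) : ℂ) * f ξ :=
  (memLp_modulation y f).coeFn_toLp

theorem coeFn_shift (k : Fin d → ℤ) (f : L2 d) :
    shift k f =ᵐ[volume] fun x => f (x - latticePoint k) :=
  Lp.coeFn_compMeasurePreserving f (measurePreserving_sub_right volume (latticePoint k))

/-- Both sides are continuous in f, so Schwartz functions suffice, and there the substitution takes
place in the Fourier integral. -/
theorem fourier_shift (k : Fin d → ℤ) (f : L2 d) :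
    𝓕 (shift k f) = modulation (latticePoint k) (𝓕 f) := by
  apply DenseRange.induction_on (p := fun f : L2 d =>
    𝓕 (shift k f) = modulation (latticePoint k) (𝓕 f))
    (SchwartzMap.denseRange_toLpCLM (E := Rd d) (F := ℂ) (p := 2) (μ := volume)
      ENNReal.ofNat_ne_top) f
  · apply isClosed_eq
    · exact (Lp.fourierTransformₗᵢ (Rd d) ℂ).continuous.comp (shift k).continuous
    · exact (modulation (latticePoint k)).continuous.comp
        (Lp.fourierTransformₗᵢ (Rd d) ℂ).continuous
  · intro g
    rw [SchwartzMap.toLpCLM_apply]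
    have h1 : shift k (g.toLp 2) =
        (SchwartzMap.compSubConstCLM ℂ (latticePoint k) g).toLp 2 := by
      apply Lp.ext
      refine (coeFn_shift k _).trans ?_
      refine EventuallyEq.trans ?_ (SchwartzMap.coeFn_toLp _ 2 volume).symm
      filter_upwards [(measurePreserving_sub_right volume
        (latticePoint k)).quasiMeasurePreserving.ae (SchwartzMap.coeFn_toLp g 2 volume)] with x hx
      rw [hx]
      rfl
    rw [h1, SchwartzMap.toLp_fourier_eq, SchwartzMap.toLp_fourier_eq]
    apply Lp.ext
    refine (SchwartzMap.coeFn_toLp _ 2 volume).trans ?_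
    refine EventuallyEq.trans ?_ (coeFn_modulation _ _).symm
    filter_upwards [SchwartzMap.coeFn_toLp (𝓕 g) 2 volume] with x hx
    rw [hx, SchwartzMap.fourier_coe, SchwartzMap.fourier_coe, Real.fourier_eq, Real.fourier_eq,
      ← integral_add_right_eq_self _ (latticePoint k), ← integral_const_mul]
    apply integral_congr_ae
    refine Eventually.of_forall fun v => ?_
    simp only [SchwartzMap.compSubConstCLM_apply, add_sub_cancel_right, inner_add_left, neg_add,
      AddChar.map_add_eq_mul, Circle.smul_def, Circle.coe_mul, smul_eq_mul]
    ring

theorem det_adjoint_eq (A : Rd d →ₗ[ℝ] Rd d) :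
    LinearMap.det (LinearMap.adjoint A) = LinearMap.det A := by
  have h := LinearMap.toMatrix_adjoint (EuclideanSpace.basisFun (Fin d) ℝ)
    (EuclideanSpace.basisFun (Fin d) ℝ) A
  rw [← LinearMap.det_toMatrix (EuclideanSpace.basisFun (Fin d) ℝ).toBasis A,
    ← LinearMap.det_toMatrix (EuclideanSpace.basisFun (Fin d) ℝ).toBasis, h,
    Matrix.det_conjTranspose, star_trivial]

/-- The pairing hypothesis encodes that C is the inverse adjoint of B; in this form it applies
directly to integer powers through `IsExpansiveDilation.inner_zpow`. The proof is again density of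
Schwartz functions and a change of variables. -/
theorem fourier_dilation (B C : Rd d ≃ₗ[ℝ] Rd d)
    (hBC : ∀ x y, inner ℝ (B x) (C y) = inner ℝ x y) (f : L2 d) :
    𝓕 (dilation B f) = dilation C (𝓕 f) := by
  apply DenseRange.induction_on (p := fun f : L2 d =>
    𝓕 (dilation B f) = dilation C (𝓕 f))
    (SchwartzMap.denseRange_toLpCLM (E := Rd d) (F := ℂ) (p := 2) (μ := volume)
      ENNReal.ofNat_ne_top) f
  · apply isClosed_eq
    · exact (Lp.fourierTransformₗᵢ (Rd d) ℂ).continuous.comp (continuous_dilation B)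
    · exact (continuous_dilation C).comp (Lp.fourierTransformₗᵢ (Rd d) ℂ).continuous
  · intro g
    rw [SchwartzMap.toLpCLM_apply]
    have hdet : LinearMap.det (C : Rd d →ₗ[ℝ] Rd d) * LinearMap.det (B : Rd d →ₗ[ℝ] Rd d) = 1 := by
      have h : LinearMap.adjoint (B : Rd d →ₗ[ℝ] Rd d) ∘ₗ (C : Rd d →ₗ[ℝ] Rd d)
          = LinearMap.id := by
        ext1 y
        refine ext_inner_left ℝ fun x => ?_
        simp [LinearMap.adjoint_inner_right, hBC]
      have h2 := congrArg LinearMap.det h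
      rw [LinearMap.det_comp, det_adjoint_eq, LinearMap.det_id] at h2
      simpa [mul_comm] using h2
    set b := Real.sqrt |LinearMap.det (B : Rd d →ₗ[ℝ] Rd d)| with hb
    set c := Real.sqrt |LinearMap.det (C : Rd d →ₗ[ℝ] Rd d)| with hc
    have h1 : dilation B (g.toLp 2) =
        ((b : ℂ) • SchwartzMap.compCLMOfContinuousLinearEquiv ℂ B.toContinuousLinearEquiv g).toLp 2
        := by
      apply Lp.ext
      refine (coeFn_dilationFun B _).trans ?_
      refine EventuallyEq.trans ?_ (SchwartzMap.coeFn_toLp _ 2 volume).symm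
      filter_upwards [(quasiMeasurePreserving_equiv B).ae
        (SchwartzMap.coeFn_toLp g 2 volume)] with x hx
      rw [hx]
      rfl
    rw [h1, SchwartzMap.toLp_fourier_eq, SchwartzMap.toLp_fourier_eq]
    apply Lp.ext
    refine (SchwartzMap.coeFn_toLp _ 2 volume).trans ?_
    refine EventuallyEq.trans ?_ (coeFn_dilationFun _ _).symm
    filter_upwards [(quasiMeasurePreserving_equiv C).ae
      (SchwartzMap.coeFn_toLp (𝓕 g) 2 volume)] with x hx
    rw [hx, SchwartzMap.fourier_coe, SchwartzMap.fourier_coe, Real.fourier_eq, Real.fourier_eq]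
    have h3 : ∀ v, (𝐞 (-(inner ℝ v x)) : Circle) •
        ((b : ℂ) • SchwartzMap.compCLMOfContinuousLinearEquiv ℂ B.toContinuousLinearEquiv g) v
        = (b : ℂ) * (fun w => (𝐞 (-(inner ℝ w (C x))) : Circle) • g w)
          ((B : Rd d →ₗ[ℝ] Rd d) v) := by
      intro v
      have : inner ℝ ((B : Rd d →ₗ[ℝ] Rd d) v) (C x) = inner ℝ v x := hBC v x
      simp only [this, Circle.smul_def, smul_eq_mul, smul_apply,
        SchwartzMap.compCLMOfContinuousLinearEquiv_apply, Function.comp]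
      simp only [LinearEquiv.coe_coe, LinearEquiv.coe_toContinuousLinearEquiv']
      ring
    simp_rw [h3]
    rw [integral_const_mul]
    have h4 := Measure.map_linearMap_addHaar_eq_smul_addHaar (volume : Measure (Rd d))
      (f := (B : Rd d →ₗ[ℝ] Rd d)) B.isUnit_det'.ne_zero
    have hm : MeasurableEmbedding (B : Rd d →ₗ[ℝ] Rd d) :=
      B.toContinuousLinearEquiv.toHomeomorph.measurableEmbedding
    have h5 := hm.integral_map (μ := (volume : Measure (Rd d)))
      (fun w => (𝐞 (-(inner ℝ w (C x))) : Circle) • g w)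
    rw [← h5, h4, integral_smul_measure, ENNReal.toReal_ofReal (abs_nonneg _), Complex.real_smul,
      ← mul_assoc, ← Complex.ofReal_mul]
    congr 2
    have hd : |LinearMap.det (B : Rd d →ₗ[ℝ] Rd d)|⁻¹ = |LinearMap.det (C : Rd d →ₗ[ℝ] Rd d)| := by
      rw [inv_eq_iff_eq_inv]
      refine eq_inv_of_mul_eq_one_right ?_
      rw [← abs_mul, hdet, abs_one]
    have hb0 : b ≠ 0 := (Real.sqrt_pos.mpr (abs_pos.mpr B.isUnit_det'.ne_zero)).ne'
    have hb2 : |LinearMap.det (B : Rd d →ₗ[ℝ] Rd d)| = b ^ 2 := (Real.sq_sqrt (abs_nonneg _)).symm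
    rw [abs_inv, ← hd, Real.sqrt_inv, ← hb, hb2]
    field_simp

/-! ### Parseval's identity on unit boxes -/

/-- The half-open unit cube centred at `c`. -/
def unitBox (c : Rd d) : Set (Rd d) := {x | ∀ i, x i ∈ Set.Ioc (c i - 1 / 2) (c i - 1 / 2 + 1)}

theorem measurableSet_unitBox (c : Rd d) : MeasurableSet (unitBox c) := by
  simp only [unitBox, Set.ofPred_forall]
  refine MeasurableSet.iInter fun i => ?_
  exact (by fun_prop : Measurable fun x : Rd d => x i) measurableSet_Ioc

theorem unitBox_mem_nhds (c : Rd d) : unitBox c ∈ 𝓝 c := by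
  simp only [unitBox, Set.ofPred_forall]
  refine (Filter.iInter_mem).mpr fun i => ?_
  have : ContinuousAt (fun x : Rd d => x i) c := by fun_prop
  exact this (Ioc_mem_nhds (by linarith) (by linarith))

theorem isBounded_unitBox (c : Rd d) : Bornology.IsBounded (unitBox c) := by
  have h : Bornology.IsBounded (Set.univ.pi fun i => Set.Icc (c i - 1 / 2) (c i - 1 / 2 + 1)) :=
    (isCompact_univ_pi fun i => isCompact_Icc).isBounded
  have h2 := (PiLp.lipschitzWith_toLp 2 (fun _ : Fin d => ℝ)).isBounded_image h
  refine h2.subset fun x hx => ⟨fun i => x i, fun i _ => ⟨(hx i).1.le, (hx i).2⟩, rfl⟩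

section Torus

/-- The Haar probability measure on `ℝ / ℤ`. -/
local instance instMeasureSpaceUnitAddCircle : MeasureSpace UnitAddCircle :=
  ⟨AddCircle.haarAddCircle⟩

/-- The map is the section of the quotient ℝᵈ → ℝᵈ/ℤᵈ with values in the box; it carries Fourier
series on the torus over to the box. -/
theorem exists_measurePreserving_unitBox (c : Rd d) :
    ∃ ρ : UnitAddTorus (Fin d) → Rd d,
      MeasurePreserving ρ volume (volume.restrict (unitBox c)) ∧
        ∀ t i, ((ρ t i : ℝ) : UnitAddCircle) = t i := by
  set a : Fin d → ℝ := fun i => c i - 1 / 2 with ha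
  have hbox : MeasurableSet {x : Fin d → ℝ | ∀ i, x i ∈ Set.Ioc (a i) (a i + 1)} :=
    MeasurableSet.univ_pi' (fun i => measurableSet_Ioc)
  have h1 := UnitAddTorus.measurePreserving_equivPiIoc a
  have h2 : MeasurePreserving
      (Subtype.val : {x : Fin d → ℝ // ∀ i, x i ∈ Set.Ioc (a i) (a i + 1)} → Fin d → ℝ)
      (Measure.comap Subtype.val volume)
      (volume.restrict {x : Fin d → ℝ | ∀ i, x i ∈ Set.Ioc (a i) (a i + 1)}) :=
    ⟨measurable_subtype_coe, map_comap_subtype_coe hbox volume⟩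
  have h3 := (PiLp.volume_preserving_toLp (Fin d)).restrict_preimage (measurableSet_unitBox c)
  refine ⟨_, (h3.comp h2).comp h1, fun t i => ?_⟩
  simp only [Function.comp]
  exact AddCircle.coe_equivIoc

theorem mFourier_eq_fourierChar (n : Fin d → ℤ) (t : UnitAddTorus (Fin d)) (x : Rd d)
    (h : ∀ i, ((x i : ℝ) : UnitAddCircle) = t i) :
    UnitAddTorus.mFourier n t = (𝐞 (inner ℝ (latticePoint n) x) : ℂ) := by
  have h1 : UnitAddTorus.mFourier n t = ∏ i, fourier (n i) (t i) := rfl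
  rw [h1, Real.fourierChar_apply]
  simp_rw [← h, fourier_coe_apply]
  rw [← Complex.exp_sum]
  congr 1
  simp only [latticePoint, PiLp.inner_apply, RCLike.inner_apply, conj_trivial]
  push_cast
  rw [Finset.mul_sum, Finset.sum_mul]
  refine Finset.sum_congr rfl fun i _ => ?_
  ring

/-- Since E sits in a single box, h restricted to E and extended by zero is a function on the torus;
the integrals are its Fourier coefficients and the identity is Parseval's. -/
theorem hasSum_sq_setIntegral_fourierChar (c : Rd d) (h : L2 d) {E : Set (Rd d)}
    (hE : MeasurableSet E) (hEc : E ⊆ unitBox c) :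
    HasSum (fun k : Fin d → ℤ => ‖∫ ξ in E, (𝐞 (-(inner ℝ (latticePoint k) ξ)) : ℂ) * h ξ‖ ^ 2)
      (∫ ξ in E, ‖h ξ‖ ^ 2) := by
  obtain ⟨ρ, hρ, hρt⟩ := exists_measurePreserving_unitBox c
  have hm : MemLp (E.indicator h) 2 (volume.restrict (unitBox c)) :=
    ((Lp.memLp h).indicator hE).restrict _
  have hG := hm.comp_measurePreserving hρ
  have hint {F : Type} [NormedAddCommGroup F] [NormedSpace ℝ F] (g : Rd d → F)
      (hg : AEStronglyMeasurable g (volume.restrict (unitBox c))) :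
      ∫ t, g (ρ t) = ∫ ξ in unitBox c, g ξ := by
    rw [← hρ.map_eq] at hg ⊢
    exact (integral_map hρ.measurable.aemeasurable hg).symm
  set G : Lp ℂ 2 (volume : Measure (UnitAddTorus (Fin d))) := hG.toLp
  have hGρ : ∀ᵐ t, G t = E.indicator h (ρ t) := hG.coeFn_toLp
  have key := UnitAddTorus.hasSum_sq_mFourierCoeff G
  convert key using 1
  · ext k
    congr 2
    have h1 : UnitAddTorus.mFourierCoeff G k
        = ∫ t, (fun ξ => (𝐞 (-(inner ℝ (latticePoint k) ξ)) : ℂ) * E.indicator h ξ) (ρ t) := by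
      apply integral_congr_ae
      filter_upwards [hGρ] with t ht
      rw [ht, mFourier_eq_fourierChar (-k) t (ρ t) (hρt t), smul_eq_mul]
      have : inner ℝ (latticePoint (-k)) (ρ t) = -inner ℝ (latticePoint k) (ρ t) := by
        rw [← inner_neg_left]
        congr 1
        ext i
        simp [latticePoint]
      rw [this]
    rw [h1, hint (fun ξ => (𝐞 (-(inner ℝ (latticePoint k) ξ)) : ℂ) * E.indicator h ξ)
      ((by fun_prop : AEStronglyMeasurable
        (fun ξ => (𝐞 (-(inner ℝ (latticePoint k) ξ)) : ℂ)) _).mul hm.1)]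
    have h2 : (fun ξ => (𝐞 (-(inner ℝ (latticePoint k) ξ)) : ℂ) * E.indicator h ξ) =
        E.indicator fun ξ => (𝐞 (-(inner ℝ (latticePoint k) ξ)) : ℂ) * h ξ := by
      ext ξ
      by_cases hξ : ξ ∈ E <;> simp [hξ]
    rw [h2, setIntegral_indicator hE, Set.inter_eq_right.mpr hEc]
  · have h1 : ∫ t, ‖G t‖ ^ 2 = ∫ t, (fun ξ => ‖E.indicator h ξ‖ ^ 2) (ρ t) := by
      apply integral_congr_ae
      filter_upwards [hGρ] with t ht
      rw [ht]
    rw [h1, hint (fun ξ => ‖E.indicator h ξ‖ ^ 2) (hm.1.norm.pow 2)]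
    have : (fun ξ => ‖E.indicator h ξ‖ ^ 2) = E.indicator (fun ξ => ‖h ξ‖ ^ 2) := by
      ext ξ
      by_cases hξ : ξ ∈ E <;> simp [hξ]
    rw [this, setIntegral_indicator hE, Set.inter_eq_right.mpr hEc]

end Torus

/-! ### Inverse powers of an expansive dilation are contractive -/

/-- By Gelfand's formula, ‖aⁿ‖ is eventually at most rⁿ for some r < 1. -/
theorem tendsto_pow_of_spectralRadius_lt_one {R : Type*} [NormedRing R] [NormedAlgebra ℂ R]
    [CompleteSpace R] {a : R} (ha : spectralRadius ℂ a < 1) :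
    Tendsto (fun n : ℕ => a ^ n) atTop (𝓝 0) := by
  obtain ⟨r, har, hr1⟩ := ENNReal.lt_iff_exists_nnreal_btwn.mp ha
  have hr1' : r < 1 := by exact_mod_cast hr1
  have h := spectrum.pow_nnnorm_pow_one_div_tendsto_nhds_spectralRadius a
  rw [tendsto_zero_iff_norm_tendsto_zero]
  refine squeeze_zero' (Eventually.of_forall fun n => norm_nonneg _) ?_
    (tendsto_pow_atTop_nhds_zero_of_lt_one r.2 hr1')
  filter_upwards [h.eventually_lt_const har, eventually_gt_atTop 0] with n hn hn0
  have hn0' : (0 : ℝ) < n := by exact_mod_cast hn0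
  have h2 : (‖a ^ n‖₊ : ℝ≥0∞) ≤ (r : ℝ≥0∞) ^ n := by
    have := ENNReal.rpow_le_rpow hn.le hn0'.le
    rwa [← ENNReal.rpow_mul, one_div, inv_mul_cancel₀ hn0'.ne', ENNReal.rpow_one,
      ENNReal.rpow_natCast] at this
  have h3 : ‖a ^ n‖₊ ≤ r ^ n := by exact_mod_cast h2
  exact_mod_cast h3

/-- The complex matrix of a real endomorphism in the standard basis. -/
def complexMatrix (d : ℕ) : Module.End ℝ (Rd d) →+* Matrix (Fin d) (Fin d) ℂ :=
  (algebraMap ℝ ℂ).mapMatrix.comp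
    (LinearMap.toMatrixAlgEquiv (EuclideanSpace.basisFun (Fin d) ℝ).toBasis).toRingEquiv.toRingHom

theorem complexMatrix_apply (T : Module.End ℝ (Rd d)) (i j : Fin d) :
    complexMatrix d T i j = ((T (EuclideanSpace.basisFun (Fin d) ℝ j) i : ℝ) : ℂ) := by
  simp [complexMatrix, LinearMap.toMatrixAlgEquiv_apply]

theorem spectrum_complexMatrix (T : Module.End ℝ (Rd d)) :
    spectrum ℂ (complexMatrix d T) = spectrum ℂ (T.baseChange ℂ) := by
  have h := LinearMap.toMatrix_baseChange ℂ T (EuclideanSpace.basisFun (Fin d) ℝ).toBasis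
    (EuclideanSpace.basisFun (Fin d) ℝ).toBasis
  rw [← AlgEquiv.spectrum_eq (LinearMap.toMatrixAlgEquiv (Algebra.TensorProduct.basis ℂ
    (EuclideanSpace.basisFun (Fin d) ℝ).toBasis)) (T.baseChange ℂ)]
  congr 1
  exact h.symm

section MatrixNorm

attribute [local instance] Matrix.linftyOpNormedRing Matrix.linftyOpNormedAlgebra

theorem IsExpansiveDilation.tendsto_complexMatrix_inv (hd : 0 < d) {A : Rd d →ₗ[ℝ] Rd d}
    (hA : IsExpansiveDilation A) :
    Tendsto (fun n : ℕ => complexMatrix d (hA.equiv.symm : Module.End ℝ (Rd d)) ^ n) atTop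
      (𝓝 0) := by
  have : Nonempty (Fin d) := ⟨⟨0, hd⟩⟩
  apply tendsto_pow_of_spectralRadius_lt_one
  have h1 : complexMatrix d A * complexMatrix d (hA.equiv.symm : Module.End ℝ (Rd d)) = 1 := by
    rw [← map_mul, ← map_one (complexMatrix d)]
    congr 1
    ext1 x
    exact hA.equiv.apply_symm_apply x
  have h2 : complexMatrix d (hA.equiv.symm : Module.End ℝ (Rd d)) * complexMatrix d A = 1 := by
    rw [← map_mul, ← map_one (complexMatrix d)]
    congr 1
    ext1 x
    exact hA.equiv.symm_apply_apply x
  let u : (Matrix (Fin d) (Fin d) ℂ)ˣ := ⟨_, _, h1, h2⟩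
  -- Spectral values of the inverse are inverses of eigenvalues of A, so expansiveness puts them
  -- inside the open unit disc.
  refine spectrum.spectralRadius_lt_of_forall_lt (r := 1) _ fun z hz => ?_
  have hz' : z⁻¹ ∈ spectrum ℂ (complexMatrix d A) := by
    have := spectrum.map_inv (𝕜 := ℂ) u
    have hz2 : z ∈ (spectrum ℂ (u : Matrix (Fin d) (Fin d) ℂ))⁻¹ := by rw [this]; exact hz
    exact hz2
  rw [spectrum_complexMatrix, ← Module.End.hasEigenvalue_iff_mem_spectrum] at hz'
  have h3 := hA.one_lt_norm _ hz'
  rw [norm_inv] at h3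
  have h4 : ‖z‖ < 1 := by
    by_contra hcon
    exact absurd (inv_le_one_of_one_le₀ (not_lt.mp hcon)) (not_le.mpr h3)
  exact_mod_cast h4

theorem IsExpansiveDilation.inner_zpow {A : Rd d →ₗ[ℝ] Rd d} (hA : IsExpansiveDilation A)
    (j : ℤ) (x y : Rd d) :
    inner ℝ ((hA.equiv ^ j) x) ((hA.adjointEquiv ^ (-j)) y) = inner ℝ x y := by
  have h0 : ∀ x y, inner ℝ (hA.equiv x) y = inner ℝ x (hA.adjointEquiv y) := fun x y =>
    (LinearMap.adjoint_inner_right A x y).symm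
  have h1 : ∀ (n : ℕ) x y, inner ℝ ((hA.equiv ^ n) x) y = inner ℝ x ((hA.adjointEquiv ^ n) y) := by
    intro n
    induction n with
    | zero => intro x y; rfl
    | succ n ih =>
      intro x y
      rw [pow_succ, pow_succ']
      change inner ℝ ((hA.equiv ^ n) (hA.equiv x)) y =
        inner ℝ x (hA.adjointEquiv ((hA.adjointEquiv ^ n) y))
      rw [ih, h0]
  obtain ⟨n, rfl | rfl⟩ := j.eq_nat_or_neg
  · rw [zpow_natCast, h1, zpow_neg, zpow_natCast]
    congr 1
    exact (hA.adjointEquiv ^ n).apply_symm_apply y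
  · rw [neg_neg, zpow_natCast, ← h1, zpow_neg, zpow_natCast]
    congr 1
    exact (hA.equiv ^ n).apply_symm_apply x

theorem IsExpansiveDilation.eventually_norm_equiv_zpow_le (hd : 0 < d) {A : Rd d →ₗ[ℝ] Rd d}
    (hA : IsExpansiveDilation A) {ε : ℝ} (hε : 0 < ε) :
    ∀ᶠ j : ℕ in atTop, ∀ x, ‖(hA.equiv ^ (-(j : ℤ))) x‖ ≤ ε * ‖x‖ := by
  have hpow : ∀ j : ℕ, ∀ x, (hA.equiv ^ (-(j : ℤ))) x
      = ((hA.equiv.symm : Module.End ℝ (Rd d)) ^ j) x := by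
    intro j
    rw [zpow_neg, zpow_natCast, ← inv_pow]
    induction j with
    | zero => intro x; rfl
    | succ n ih => intro x; rw [pow_succ, pow_succ]; exact ih _
  have hentry : ∀ l, Tendsto (fun j : ℕ =>
      (hA.equiv ^ (-(j : ℤ))) (EuclideanSpace.basisFun (Fin d) ℝ l)) atTop (𝓝 0) := by
    intro l
    have h : Tendsto (fun j : ℕ => fun i : Fin d =>
      (hA.equiv ^ (-(j : ℤ))) (EuclideanSpace.basisFun (Fin d) ℝ l) i) atTop (𝓝 0) := by
      rw [tendsto_pi_nhds]
      intro i
      have h1 : Tendsto (fun n : ℕ =>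
          (complexMatrix d (hA.equiv.symm : Module.End ℝ (Rd d)) ^ n) i l) atTop (𝓝 0) := by
        have hc : Continuous fun Q : Matrix (Fin d) (Fin d) ℂ => Q i l := by fun_prop
        exact (hc.tendsto 0).comp (hA.tendsto_complexMatrix_inv hd)
      have h2 := (Complex.continuous_re.tendsto 0).comp h1
      simp only [hpow]
      simpa [Function.comp_def, ← map_pow, complexMatrix_apply] using h2
    exact ((PiLp.continuous_toLp 2 (fun _ : Fin d => ℝ)).tendsto 0).comp h
  have hsum : Tendsto (fun j : ℕ => ∑ l,
      ‖(hA.equiv ^ (-(j : ℤ))) (EuclideanSpace.basisFun (Fin d) ℝ l)‖) atTop (𝓝 0) := by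
    simpa using tendsto_finsetSum Finset.univ fun l _ => (hentry l).norm
  filter_upwards [hsum.eventually_le_const hε] with j hj x
  calc ‖(hA.equiv ^ (-(j : ℤ))) x‖
      = ‖∑ l, x l • (hA.equiv ^ (-(j : ℤ))) (EuclideanSpace.basisFun (Fin d) ℝ l)‖ := by
        conv_lhs => rw [← (EuclideanSpace.basisFun (Fin d) ℝ).sum_repr x]
        rw [map_sum]
        simp
    _ ≤ ∑ l, ‖x‖ * ‖(hA.equiv ^ (-(j : ℤ))) (EuclideanSpace.basisFun (Fin d) ℝ l)‖ := by
        refine norm_sum_le_of_le _ fun l _ => ?_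
        rw [norm_smul]
        gcongr
        exact PiLp.norm_apply_le x l
    _ ≤ ε * ‖x‖ := by
        rw [← Finset.mul_sum, mul_comm]
        gcongr

/-- An operator and its adjoint have the same norm: for z = A*⁻ʲy one has ‖z‖² = ⟨A⁻ʲz, y⟩, and the
bound for A⁻ʲ applies. -/
theorem IsExpansiveDilation.eventually_norm_adjointEquiv_zpow_le (hd : 0 < d)
    {A : Rd d →ₗ[ℝ] Rd d} (hA : IsExpansiveDilation A) {ε : ℝ} (hε : 0 < ε) :
    ∀ᶠ j : ℕ in atTop, ∀ x, ‖(hA.adjointEquiv ^ (-(j : ℤ))) x‖ ≤ ε * ‖x‖ := by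
  filter_upwards [hA.eventually_norm_equiv_zpow_le hd hε] with j hj y
  set z := (hA.adjointEquiv ^ (-(j : ℤ))) y with hz
  have h1 : inner ℝ z z = inner ℝ ((hA.equiv ^ (-(j : ℤ))) z) y := by
    have h := hA.inner_zpow j ((hA.equiv ^ (-(j : ℤ))) z) y
    rw [← h, ← hz, zpow_neg]
    congr 1
    exact ((hA.equiv ^ (j : ℤ)).apply_symm_apply z).symm
  rcases eq_or_ne z 0 with h0 | h0
  · rw [h0, norm_zero]
    positivity
  have h2 : ‖z‖ * ‖z‖ ≤ ε * ‖y‖ * ‖z‖ := by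
    rw [← real_inner_self_eq_norm_mul_norm, h1]
    calc _ ≤ ‖(hA.equiv ^ (-(j : ℤ))) z‖ * ‖y‖ := real_inner_le_norm _ _
      _ ≤ ε * ‖z‖ * ‖y‖ := by gcongr; exact hj z
      _ = _ := by ring
  exact le_of_mul_le_mul_right h2 (norm_pos_iff.mpr h0)

end MatrixNorm

/-! ### The spectral function through projections of wave packets -/

instance instSeparableSpaceL2 : TopologicalSpace.SeparableSpace (L2 d) := by
  have : Fact ((2 : ℝ≥0∞) ≠ ∞) := ⟨by simp⟩
  infer_instance

/-- The function whose Fourier transform is the indicator of `E`. -/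
def packet {E : Set (Rd d)} (hE : MeasurableSet E) (hfin : volume E ≠ ∞) : L2 d :=
  𝓕⁻ (indicatorConstLp 2 hE hfin (1 : ℂ) : L2 d)

theorem fourier_packet {E : Set (Rd d)} (hE : MeasurableSet E) (hfin : volume E ≠ ∞) :
    𝓕 (packet hE hfin) = (indicatorConstLp 2 hE hfin (1 : ℂ) : L2 d) :=
  FourierTransform.fourier_fourierInv_eq (indicatorConstLp 2 hE hfin (1 : ℂ) : L2 d)

theorem inner_packet {E : Set (Rd d)} (hE : MeasurableSet E) (hfin : volume E ≠ ∞) (f : L2 d) :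
    inner ℂ (packet hE hfin) f = ∫ ξ in E, (𝓕 f : L2 d) ξ := by
  rw [← Lp.inner_fourier_eq, fourier_packet, L2.inner_indicatorConstLp_one]

theorem inner_packet_shift {E : Set (Rd d)} (hE : MeasurableSet E) (hfin : volume E ≠ ∞)
    (k : Fin d → ℤ) (f : L2 d) :
    inner ℂ (packet hE hfin) (shift k f) =
      ∫ ξ in E, (𝐞 (-(inner ℝ (latticePoint k) ξ)) : ℂ) * (𝓕 f : L2 d) ξ := by
  rw [inner_packet, fourier_shift]
  exact integral_congr_ae (ae_restrict_of_ae (coeFn_modulation _ _))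

theorem norm_packet_sq {E : Set (Rd d)} (hE : MeasurableSet E) (hfin : volume E ≠ ∞) :
    ‖packet hE hfin‖ ^ 2 = volume.real E := by
  rw [← Lp.norm_fourier_eq, fourier_packet, norm_indicatorConstLp (by simp) (by simp)]
  simp only [norm_one, one_mul, ENNReal.toReal_ofNat]
  rw [← Real.sqrt_eq_rpow, Real.sq_sqrt measureReal_nonneg]

theorem volume_ne_top_of_subset_unitBox {E : Set (Rd d)} {c : Rd d} (h : E ⊆ unitBox c) :
    volume E ≠ ∞ :=
  ((measure_mono h).trans_lt (isBounded_unitBox c).measure_lt_top).ne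

theorem tsum_ofReal_sq_inner_packet_shift {E : Set (Rd d)} (hE : MeasurableSet E) {c : Rd d}
    (hEc : E ⊆ unitBox c) (f : L2 d) :
    ∑' k : Fin d → ℤ, ENNReal.ofReal
        (‖inner ℂ (packet hE (volume_ne_top_of_subset_unitBox hEc)) (shift k f)‖ ^ 2) =
      ∫⁻ ξ in E, ENNReal.ofReal (‖(𝓕 f : L2 d) ξ‖ ^ 2) := by
  have h := hasSum_sq_setIntegral_fourierChar c (𝓕 f) hE hEc
  simp_rw [inner_packet_shift]
  rw [← ENNReal.ofReal_tsum_of_nonneg (fun _ => by positivity) h.summable, h.tsum_eq]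
  refine ofReal_integral_eq_lintegral_ofReal ?_ (Eventually.of_forall fun ξ => by positivity)
  exact ((Lp.memLp (𝓕 f : L2 d)).integrable_norm_pow (p := 2) two_ne_zero).restrict

theorem inner_starProjection_eq {V : Submodule ℂ (L2 d)} [V.HasOrthogonalProjection] (f : L2 d)
    {g : L2 d} (hg : g ∈ V) : inner ℂ (V.starProjection f) g = inner ℂ f g := by
  rw [Submodule.inner_starProjection_left_eq_right, Submodule.starProjection_eq_self_iff.mpr hg]

/-- The frame elements lie in V, so f and its projection have the same coefficients. -/
theorem IsTightFrameGenerator.hasSum_projection {V : Submodule ℂ (L2 d)}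
    [V.HasOrthogonalProjection] (hV : IsShiftInvariant V) {ι : Type} {φ : ι → L2 d}
    (hφ : IsTightFrameGenerator φ V) (f : L2 d) :
    HasSum (fun p : ι × (Fin d → ℤ) => ‖inner ℂ f (shift p.2 (φ p.1))‖ ^ 2)
      (‖V.starProjection f‖ ^ 2) := by
  have h := hφ.2 _ (V.starProjection_apply_mem f)
  simpa only [inner_starProjection_eq f (hV.shift_mem _ (hφ.1 _) _)] using h

theorem IsTightFrameGenerator.tsum_lintegral_fourier_sq {V : Submodule ℂ (L2 d)}
    [V.HasOrthogonalProjection] (hV : IsShiftInvariant V) {ι : Type} {φ : ι → L2 d}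
    (hφ : IsTightFrameGenerator φ V) {E : Set (Rd d)} (hE : MeasurableSet E) {c : Rd d}
    (hEc : E ⊆ unitBox c) :
    ∑' i, ∫⁻ ξ in E, ENNReal.ofReal (‖(𝓕 (φ i) : L2 d) ξ‖ ^ 2) = ENNReal.ofReal
      (‖V.starProjection (packet hE (volume_ne_top_of_subset_unitBox hEc))‖ ^ 2) := by
  have h := hφ.hasSum_projection hV (packet hE (volume_ne_top_of_subset_unitBox hEc))
  rw [← h.tsum_eq, ENNReal.ofReal_tsum_of_nonneg (fun _ => by positivity) h.summable,
    ENNReal.tsum_prod (f := fun i k => ENNReal.ofReal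
      (‖inner ℂ (packet hE (volume_ne_top_of_subset_unitBox hEc)) (shift k (φ i))‖ ^ 2))]
  simp_rw [tsum_ofReal_sq_inner_packet_shift hE hEc]

theorem shift_zero (f : L2 d) : shift 0 f = f := by
  apply Lp.ext
  filter_upwards [coeFn_shift 0 f] with x hx
  have h0 : latticePoint (0 : Fin d → ℤ) = 0 := by ext i; simp [latticePoint]
  rw [hx, h0, sub_zero]

theorem shift_shift_neg (k : Fin d → ℤ) (f : L2 d) : shift k (shift (-k) f) = f := by
  apply Lp.ext
  filter_upwards [coeFn_shift k (shift (-k) f),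
    (measurePreserving_sub_right volume (latticePoint k)).quasiMeasurePreserving.ae
      (coeFn_shift (-k) f)] with x hx hx2
  have h0 : x - latticePoint k - latticePoint (-k) = x := by ext i; simp [latticePoint]
  rw [hx, hx2, h0]

/-- Each f has only countably many nonzero frame coefficients. Letting f run through a countable
dense set catches every nonzero generator, already through its untranslated copy k = 0. -/
theorem IsTightFrameGenerator.countable_ne_zero {V : Submodule ℂ (L2 d)}
    [V.HasOrthogonalProjection] (hV : IsShiftInvariant V) {ι : Type} {φ : ι → L2 d}
    (hφ : IsTightFrameGenerator φ V) : {i | φ i ≠ 0}.Countable := by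
  obtain ⟨s, hs, hsd⟩ := TopologicalSpace.exists_countable_dense (L2 d)
  have hc : (⋃ f ∈ s, Prod.fst '' Function.support (fun p : ι × (Fin d → ℤ) =>
      ‖inner ℂ f (shift p.2 (φ p.1))‖ ^ 2)).Countable :=
    hs.biUnion fun f _ => (hφ.hasSum_projection hV f).summable.countable_support.image _
  refine hc.mono fun i hi => ?_
  by_contra hcon
  apply hi
  have h0 : ∀ f ∈ s, inner ℂ f (φ i) = 0 := by
    intro f hf
    by_contra hne
    apply hcon
    refine Set.mem_biUnion hf ⟨(i, 0), ?_, rfl⟩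
    simpa [shift_zero] using hne
  exact hsd.eq_zero_of_inner_right ℂ h0

theorem IsSpectralFunction.exists_countable {V : Submodule ℂ (L2 d)}
    [V.HasOrthogonalProjection] (hV : IsShiftInvariant V) {σ : Rd d → ℝ}
    (hσ : IsSpectralFunction V σ) :
    ∃ (ι : Type) (_ : Countable ι) (φ : ι → L2 d), IsTightFrameGenerator φ V ∧
      ∀ᵐ ξ : Rd d, HasSum (fun i => ‖(𝓕 (φ i) : L2 d) ξ‖ ^ 2) (σ ξ) := by
  obtain ⟨ι, φ, hφ, hs⟩ := hσ
  refine ⟨{i | φ i ≠ 0}, (hφ.countable_ne_zero hV).to_subtype, fun i => φ i,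
    ⟨fun i => hφ.1 i, fun f hf => ?_⟩, ?_⟩
  · have hinj : Function.Injective
        (Prod.map Subtype.val id : {i | φ i ≠ 0} × (Fin d → ℤ) → ι × (Fin d → ℤ)) :=
      Subtype.val_injective.prodMap Function.injective_id
    refine (hinj.hasSum_iff ?_).mpr (hφ.2 f hf)
    rintro ⟨i, k⟩ hik
    have : φ i = 0 := by
      by_contra hne
      exact hik ⟨(⟨i, hne⟩, k), rfl⟩
    simp [this]
  · filter_upwards [hs] with ξ h1
    refine (Subtype.val_injective.hasSum_iff ?_).mpr h1
    intro i hi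
    have : φ i = 0 := by
      by_contra hne
      exact hi ⟨⟨i, hne⟩, rfl⟩
    simp [this]

/-- On subsets of a unit box the spectral function integrates to the energy of the projected
wave packet. -/
theorem IsSpectralFunction.setLIntegral_eq {V : Submodule ℂ (L2 d)}
    [V.HasOrthogonalProjection] (hV : IsShiftInvariant V) {σ : Rd d → ℝ}
    (hσ : IsSpectralFunction V σ) {E : Set (Rd d)} (hE : MeasurableSet E) {c : Rd d}
    (hEc : E ⊆ unitBox c) :
    ∫⁻ ξ in E, ENNReal.ofReal (σ ξ) = ENNReal.ofReal
      (‖V.starProjection (packet hE (volume_ne_top_of_subset_unitBox hEc))‖ ^ 2) := by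
  -- Discarding the zero generators leaves a countable family, which is what allows sum and integral
  -- to be exchanged.
  obtain ⟨ι, _, φ, hφ, hs⟩ := hσ.exists_countable hV
  rw [← hφ.tsum_lintegral_fourier_sq hV hE hEc, ← lintegral_tsum]
  · refine lintegral_congr_ae (ae_restrict_of_ae ?_)
    filter_upwards [hs] with ξ h
    rw [← h.tsum_eq, ENNReal.ofReal_tsum_of_nonneg (fun _ => by positivity) h.summable]
  · intro i
    exact ((Lp.aestronglyMeasurable
      (𝓕 (φ i) : L2 d)).norm.pow 2).aemeasurable.ennreal_ofReal.restrict

theorem IsSpectralFunction.aemeasurable {V : Submodule ℂ (L2 d)}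
    [V.HasOrthogonalProjection] (hV : IsShiftInvariant V) {σ : Rd d → ℝ}
    (hσ : IsSpectralFunction V σ) : AEMeasurable σ := by
  obtain ⟨ι, _, φ, hφ, hs⟩ := hσ.exists_countable hV
  have h : AEMeasurable fun ξ => (∑' i, ENNReal.ofReal (‖(𝓕 (φ i) : L2 d) ξ‖ ^ 2)).toReal :=
    (AEMeasurable.tsum fun i => (((Lp.aestronglyMeasurable
      (𝓕 (φ i) : L2 d)).norm.pow 2).aemeasurable.ennreal_ofReal)).ennreal_toReal
  refine h.congr ?_
  filter_upwards [hs] with ξ h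
  rw [← ENNReal.ofReal_tsum_of_nonneg (fun _ => by positivity) h.summable, h.tsum_eq,
    ENNReal.toReal_ofReal (h.nonneg fun _ => by positivity)]

theorem IsSpectralFunction.ae_nonneg {V : Submodule ℂ (L2 d)} {σ : Rd d → ℝ}
    (hσ : IsSpectralFunction V σ) : ∀ᵐ ξ, 0 ≤ σ ξ := by
  obtain ⟨ι, φ, hφ, hs⟩ := hσ
  filter_upwards [hs] with ξ h
  exact h.nonneg fun _ => by positivity

/-! ### Existence of the spectral function -/

theorem mem_unitBox_latticePoint_iff (m : Fin d → ℤ) (x : Rd d) :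
    x ∈ unitBox (latticePoint m) ↔ ∀ i, ⌈x i - 1 / 2⌉ = m i := by
  refine forall_congr' fun i => ?_
  rw [Int.ceil_eq_iff]
  simp only [latticePoint, Set.mem_Ioc]
  constructor <;> rintro ⟨h1, h2⟩ <;> constructor <;> linarith

theorem iUnion_unitBox_latticePoint :
    ⋃ m : Fin d → ℤ, unitBox (latticePoint m) = (Set.univ : Set (Rd d)) := by
  refine Set.eq_univ_of_forall fun x => Set.mem_iUnion.mpr ⟨fun i => ⌈x i - 1 / 2⌉, ?_⟩
  rw [mem_unitBox_latticePoint_iff]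
  exact fun i => rfl

theorem ae_of_forall_restrict_unitBox {p : Rd d → Prop}
    (h : ∀ m : Fin d → ℤ, ∀ᵐ ξ ∂volume.restrict (unitBox (latticePoint m)), p ξ) :
    ∀ᵐ ξ, p ξ := by
  rw [← Measure.restrict_univ (μ := (volume : Measure (Rd d))), ← iUnion_unitBox_latticePoint,
    ae_restrict_iUnion_iff]
  exact h

theorem pairwise_disjoint_unitBox_latticePoint :
    Pairwise (Function.onFun Disjoint fun m : Fin d → ℤ => unitBox (latticePoint m)) := by
  intro m n hmn
  refine Set.disjoint_left.mpr fun x hx hx' => hmn ?_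
  rw [mem_unitBox_latticePoint_iff] at hx hx'
  ext i
  rw [← hx, ← hx']

/-- The wave packets of the integer translates of the unit box. -/
def boxPacket (m : Fin d → ℤ) : L2 d :=
  packet (measurableSet_unitBox (latticePoint m))
    (volume_ne_top_of_subset_unitBox (c := latticePoint m) subset_rfl)

theorem lintegral_ofReal_norm_fourier_sq (f : L2 d) :
    ∫⁻ ξ, ENNReal.ofReal (‖(𝓕 f : L2 d) ξ‖ ^ 2) = ENNReal.ofReal (‖f‖ ^ 2) := by
  rw [← Lp.norm_fourier_eq, ENNReal.ofReal_pow (norm_nonneg _), ofReal_norm,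
    enorm_sq_eq_lintegral]
  refine lintegral_congr fun ξ => ?_
  rw [ENNReal.ofReal_pow (norm_nonneg _), ofReal_norm]

/-- For f in V the coefficients against projected packets equal those against the packets
themselves. Summed over k they give the energy of the Fourier transform of f on one box; the boxes
tile ℝᵈ, so Plancherel finishes. -/
theorem isTightFrameGenerator_boxPacket {V : Submodule ℂ (L2 d)} [V.HasOrthogonalProjection]
    (hV : IsShiftInvariant V) :
    IsTightFrameGenerator (fun m => V.starProjection (boxPacket m)) V := by
  refine ⟨fun m => V.starProjection_apply_mem _, fun f hf => ?_⟩
  have hinner : ∀ m k, ‖inner ℂ f (shift k (V.starProjection (boxPacket m)))‖ =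
      ‖inner ℂ (boxPacket m) (shift (-k) f)‖ := by
    intro m k
    conv_lhs => rw [← shift_shift_neg k f, LinearIsometry.inner_map_map,
      ← Submodule.inner_starProjection_left_eq_right,
      Submodule.starProjection_eq_self_iff.mpr (hV.shift_mem f hf (-k))]
    exact norm_inner_symm _ _
  have hsum : ∑' p : (Fin d → ℤ) × (Fin d → ℤ),
      ENNReal.ofReal (‖inner ℂ f (shift p.2 (V.starProjection (boxPacket p.1)))‖ ^ 2) =
      ENNReal.ofReal (‖f‖ ^ 2) := by
    rw [ENNReal.tsum_prod (f := fun m k => ENNReal.ofReal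
      (‖inner ℂ f (shift k (V.starProjection (boxPacket m)))‖ ^ 2))]
    simp_rw [hinner]
    have h1 : ∀ m : Fin d → ℤ, ∑' k : Fin d → ℤ,
        ENNReal.ofReal (‖inner ℂ (boxPacket m) (shift (-k) f)‖ ^ 2) =
        ∫⁻ ξ in unitBox (latticePoint m), ENNReal.ofReal (‖(𝓕 f : L2 d) ξ‖ ^ 2) := by
      intro m
      rw [← tsum_ofReal_sq_inner_packet_shift (measurableSet_unitBox (latticePoint m)) subset_rfl]
      exact (Equiv.neg (Fin d → ℤ)).tsum_eq fun k =>
        ENNReal.ofReal (‖inner ℂ (boxPacket m) (shift k f)‖ ^ 2)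
    simp_rw [h1]
    rw [← lintegral_iUnion (fun m => measurableSet_unitBox (latticePoint m))
      pairwise_disjoint_unitBox_latticePoint, iUnion_unitBox_latticePoint, Measure.restrict_univ,
      lintegral_ofReal_norm_fourier_sq]
  have hne : ∑' p : (Fin d → ℤ) × (Fin d → ℤ),
      ENNReal.ofReal (‖inner ℂ f (shift p.2 (V.starProjection (boxPacket p.1)))‖ ^ 2) ≠ ∞ := by
    rw [hsum]
    exact ENNReal.ofReal_ne_top
  have h2 := ENNReal.hasSum_toReal hne
  rw [← ENNReal.tsum_toReal_eq (fun _ => ENNReal.ofReal_ne_top), hsum,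
    ENNReal.toReal_ofReal (by positivity)] at h2
  simpa only [ENNReal.toReal_ofReal (sq_nonneg _)] using h2

/-- The only issue is pointwise convergence: on each box the integral of the sum is a squared norm,
hence finite, so the sum is finite almost everywhere. -/
theorem exists_isSpectralFunction {V : Submodule ℂ (L2 d)} [V.HasOrthogonalProjection]
    (hV : IsShiftInvariant V) : ∃ σ : Rd d → ℝ, IsSpectralFunction V σ := by
  have hφ := isTightFrameGenerator_boxPacket hV
  set φ : (Fin d → ℤ) → L2 d := fun m => V.starProjection (boxPacket m)
  have hm : ∀ i, AEMeasurable fun ξ => ENNReal.ofReal (‖(𝓕 (φ i) : L2 d) ξ‖ ^ 2) := fun i =>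
    ((Lp.aestronglyMeasurable (𝓕 (φ i) : L2 d)).norm.pow 2).aemeasurable.ennreal_ofReal
  have hfin : ∀ᵐ ξ, ∑' i, ENNReal.ofReal (‖(𝓕 (φ i) : L2 d) ξ‖ ^ 2) < ∞ := by
    refine ae_of_forall_restrict_unitBox fun m => ?_
    refine ae_lt_top' (AEMeasurable.tsum fun i => (hm i).restrict) ?_
    rw [lintegral_tsum fun i => (hm i).restrict,
      hφ.tsum_lintegral_fourier_sq hV (measurableSet_unitBox (latticePoint m)) subset_rfl]
    exact ENNReal.ofReal_ne_top
  refine ⟨fun ξ => ∑' i, ‖(𝓕 (φ i) : L2 d) ξ‖ ^ 2, _, φ, hφ, ?_⟩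
  filter_upwards [hfin] with ξ h
  have h2 := ENNReal.hasSum_toReal h.ne
  simp only [ENNReal.toReal_ofReal (sq_nonneg _)] at h2
  exact h2

/-! ### Bounds and monotonicity of the spectral function -/

/-- The packet formula is available only inside a unit box, so pointwise inequalities have to be
tested on small sets and then glued. -/
theorem ae_le_of_locally_setLIntegral_le {f g : Rd d → ℝ≥0∞} (hf : AEMeasurable f)
    (h : ∀ x, ∃ U ∈ 𝓝 x, ∀ E : Set (Rd d), MeasurableSet E → E ⊆ U →
      ∫⁻ ξ in E, f ξ ≤ ∫⁻ ξ in E, g ξ) : ∀ᵐ ξ, f ξ ≤ g ξ := by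
  refine measure_null_of_locally_null _ fun x _ => ?_
  obtain ⟨U, hU, hUE⟩ := h x
  obtain ⟨U', hU'U, hU'o, hxU'⟩ := mem_nhds_iff.mp hU
  have hle : f ≤ᵐ[volume.restrict U'] g := by
    refine ae_le_of_forall_setLIntegral_le_of_sigmaFinite₀ hf.restrict fun s hs _ => ?_
    rw [Measure.restrict_restrict hs]
    exact hUE _ (hs.inter hU'o.measurableSet) (Set.inter_subset_right.trans hU'U)
  rw [EventuallyLE, ae_restrict_iff' hU'o.measurableSet] at hle
  refine ⟨{ξ | ¬(ξ ∈ U' → f ξ ≤ g ξ)}, ?_, hle⟩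
  filter_upwards [self_mem_nhdsWithin, mem_nhdsWithin_of_mem_nhds (hU'o.mem_nhds hxU')]
    with ξ h1 h2 h3
  exact h1 (h3 h2)

/-! ### Packets and integrals under linear changes of variable -/

theorem measurable_linearEquiv (C : Rd d ≃ₗ[ℝ] Rd d) : Measurable C :=
  C.toContinuousLinearEquiv.continuous.measurable

theorem measurableEmbedding_linearEquiv (C : Rd d ≃ₗ[ℝ] Rd d) : MeasurableEmbedding C :=
  C.toContinuousLinearEquiv.toHomeomorph.measurableEmbedding

theorem symm_zpow (B : Rd d ≃ₗ[ℝ] Rd d) (j : ℤ) : (B ^ j).symm = B ^ (-j) := (zpow_neg B j).symm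

theorem volume_preimage_ne_top (C : Rd d ≃ₗ[ℝ] Rd d) {E : Set (Rd d)} (hfin : volume E ≠ ∞) :
    volume (C ⁻¹' E) ≠ ∞ := by
  rw [show C ⁻¹' E = (C : Rd d →ₗ[ℝ] Rd d) ⁻¹' E from rfl,
    Measure.addHaar_preimage_linearMap volume C.isUnit_det'.ne_zero]
  exact ENNReal.mul_ne_top ENNReal.ofReal_ne_top hfin

theorem dilation_packet (T C : Rd d ≃ₗ[ℝ] Rd d) (hTC : ∀ x y, inner ℝ (T x) (C y) = inner ℝ x y)
    {E : Set (Rd d)} (hE : MeasurableSet E) (hfin : volume E ≠ ∞) :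
    dilation T (packet hE hfin) = ((Real.sqrt |LinearMap.det (C : Rd d →ₗ[ℝ] Rd d)| : ℝ) : ℂ) •
      packet (measurable_linearEquiv C hE) (volume_preimage_ne_top C hfin) := by
  apply (Lp.fourierTransformₗᵢ (Rd d) ℂ).injective
  rw [LinearIsometryEquiv.map_smul]
  change 𝓕 (dilation T (packet hE hfin)) = _ • 𝓕 (packet _ _)
  rw [fourier_dilation T C hTC, fourier_packet, fourier_packet]
  apply Lp.ext
  refine (coeFn_dilationFun C _).trans ?_
  filter_upwards [Lp.coeFn_smul ((Real.sqrt |LinearMap.det (C : Rd d →ₗ[ℝ] Rd d)| : ℝ) : ℂ)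
    (indicatorConstLp 2 (measurable_linearEquiv C hE) (volume_preimage_ne_top C hfin) (1 : ℂ)),
    (quasiMeasurePreserving_equiv C).ae (indicatorConstLp_coeFn (p := 2) (hs := hE)
      (hμs := hfin) (c := (1 : ℂ))),
    indicatorConstLp_coeFn (p := 2) (hs := measurable_linearEquiv C hE)
      (hμs := volume_preimage_ne_top C hfin) (c := (1 : ℂ))] with ξ h1 h2 h3
  rw [h1, Pi.smul_apply, h2, h3, smul_eq_mul]
  rfl

theorem setLIntegral_comp_equiv (C : Rd d ≃ₗ[ℝ] Rd d) {E : Set (Rd d)} (hE : MeasurableSet E)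
    (f : Rd d → ℝ≥0∞) :
    ENNReal.ofReal |LinearMap.det (C : Rd d →ₗ[ℝ] Rd d)| * ∫⁻ ξ in C ⁻¹' E, f ξ =
      ∫⁻ ξ in E, f (C.symm ξ) := by
  rw [← lintegral_indicator (measurable_linearEquiv C hE), ← lintegral_indicator hE,
    ← lintegral_comp_equiv C (E.indicator fun ξ => f (C.symm ξ))]
  congr 1
  refine lintegral_congr fun ξ => ?_
  by_cases hξ : C ξ ∈ E
  · simp [hξ]
  · simp [hξ]

section Projection

variable {V : Submodule ℂ (L2 d)} [V.HasOrthogonalProjection]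

theorem IsSpectralFunction.norm_projection_dilation_packet (hV : IsShiftInvariant V)
    {σ : Rd d → ℝ} (hσ : IsSpectralFunction V σ) (T C : Rd d ≃ₗ[ℝ] Rd d)
    (hTC : ∀ x y, inner ℝ (T x) (C y) = inner ℝ x y) {E : Set (Rd d)} (hE : MeasurableSet E)
    (hfin : volume E ≠ ∞) {c : Rd d} (hEc : C ⁻¹' E ⊆ unitBox c) :
    ENNReal.ofReal (‖V.starProjection (dilation T (packet hE hfin))‖ ^ 2) =
      ∫⁻ ξ in E, ENNReal.ofReal (σ (C.symm ξ)) := by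
  rw [dilation_packet T C hTC, map_smul, norm_smul, mul_pow, Complex.norm_real,
    Real.norm_of_nonneg (Real.sqrt_nonneg _), Real.sq_sqrt (abs_nonneg _),
    ENNReal.ofReal_mul (abs_nonneg _), ← hσ.setLIntegral_eq hV (measurable_linearEquiv C hE) hEc,
    ← setLIntegral_comp_equiv C hE fun ξ => ENNReal.ofReal (σ ξ)]

theorem norm_sub_starProjection_le (f : L2 d) {v : L2 d} (hv : v ∈ V) :
    ‖f - V.starProjection f‖ ≤ ‖f - v‖ := by
  rw [V.starProjection_minimal]
  exact ciInf_le ⟨0, by rintro _ ⟨x, rfl⟩; exact norm_nonneg _⟩ (⟨v, hv⟩ : V)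

theorem norm_starProjection_sq (f : L2 d) :
    ‖V.starProjection f‖ ^ 2 = ‖f‖ ^ 2 - ‖f - V.starProjection f‖ ^ 2 := by
  rw [V.norm_sq_eq_add_norm_sq_starProjection f, V.starProjection_orthogonal_val]
  ring

/-- Refinability writes P f as 𝒟v with v in V, and then v is a competitor for the distance of 𝒟⁻¹f
to V, at distance ‖f - P f‖. -/
theorem IsRefinable.norm_sub_projection_le {B : Rd d ≃ₗ[ℝ] Rd d} (hBV : IsRefinable B V)
    (f : L2 d) : ‖dilation B⁻¹ f - V.starProjection (dilation B⁻¹ f)‖ ≤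
      ‖f - V.starProjection f‖ := by
  obtain ⟨v, hv, hvf⟩ := hBV (V.starProjection_apply_mem f)
  refine (norm_sub_starProjection_le _ hv).trans_eq ?_
  have h : dilation B⁻¹ (dilation B v) = v := (dilation B).left_inv v
  rw [← norm_dilation B⁻¹ (f - V.starProjection f), map_sub, ← hvf]
  congr 2
  exact h.symm

theorem IsRefinable.norm_projection_le {B : Rd d ≃ₗ[ℝ] Rd d} (hBV : IsRefinable B V)
    (f : L2 d) : ‖V.starProjection f‖ ^ 2 ≤ ‖V.starProjection (dilation B⁻¹ f)‖ ^ 2 := by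
  rw [norm_starProjection_sq, norm_starProjection_sq, norm_dilation]
  have := hBV.norm_sub_projection_le f
  gcongr

theorem IsSpectralFunction.ae_le_one (hV : IsShiftInvariant V) {σ : Rd d → ℝ}
    (hσ : IsSpectralFunction V σ) : ∀ᵐ ξ, σ ξ ≤ 1 := by
  have h : ∀ᵐ ξ, ENNReal.ofReal (σ ξ) ≤ (fun _ => 1 : Rd d → ℝ≥0∞) ξ := by
    refine ae_le_of_locally_setLIntegral_le (hσ.aemeasurable hV).ennreal_ofReal
      fun x => ⟨unitBox x, unitBox_mem_nhds x, fun E hE hEx => ?_⟩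
    rw [hσ.setLIntegral_eq hV hE hEx, setLIntegral_one]
    have hne := volume_ne_top_of_subset_unitBox hEx
    calc _ ≤ ENNReal.ofReal (‖packet hE hne‖ ^ 2) := by
          gcongr
          exact V.norm_starProjection_apply_le _
      _ = volume E := by rw [norm_packet_sq, ofReal_measureReal hne]
  filter_upwards [h] with ξ hξ
  exact ENNReal.ofReal_le_one.mp hξ

variable {A : Rd d →ₗ[ℝ] Rd d} (hA : IsExpansiveDilation A)

/-- On small sets the integrals of the two sides are ‖P p_E‖² and ‖P 𝒟⁻¹p_E‖², which refinability
compares. The neighbourhood is chosen so that both E and A*⁻¹E lie in unit boxes. -/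
theorem IsSpectralFunction.ae_le_comp_inv (hV : IsShiftInvariant V)
    (hAV : IsRefinable hA.equiv V) {σ : Rd d → ℝ} (hσ : IsSpectralFunction V σ) :
    ∀ᵐ ξ, σ ξ ≤ σ (hA.adjointEquiv.symm ξ) := by
  have h : ∀ᵐ ξ, ENNReal.ofReal (σ ξ) ≤ ENNReal.ofReal (σ (hA.adjointEquiv.symm ξ)) := by
    refine ae_le_of_locally_setLIntegral_le (hσ.aemeasurable hV).ennreal_ofReal fun x =>
      ⟨unitBox x ∩ hA.adjointEquiv.symm ⁻¹' unitBox (hA.adjointEquiv.symm x),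
        inter_mem (unitBox_mem_nhds x) ?_, fun E hE hEx => ?_⟩
    · exact hA.adjointEquiv.symm.toContinuousLinearEquiv.continuous.continuousAt
        (unitBox_mem_nhds _)
    · have h1 : E ⊆ unitBox x := hEx.trans Set.inter_subset_left
      have h2 : hA.adjointEquiv ⁻¹' E ⊆ unitBox (hA.adjointEquiv.symm x) := by
        intro ξ hξ
        simpa using (hEx hξ).2
      rw [hσ.setLIntegral_eq hV hE h1, ← hσ.norm_projection_dilation_packet hV hA.equiv⁻¹
        hA.adjointEquiv (fun x y => ?_) hE (volume_ne_top_of_subset_unitBox h1) h2]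
      · exact ENNReal.ofReal_le_ofReal (hAV.norm_projection_le _)
      · simpa using hA.inner_zpow (-1) x y
  filter_upwards [h, (quasiMeasurePreserving_equiv hA.adjointEquiv.symm).ae hσ.ae_nonneg]
    with ξ h1 h2
  exact (ENNReal.ofReal_le_ofReal_iff h2).mp h1

theorem IsSpectralFunction.ae_monotone (hV : IsShiftInvariant V)
    (hAV : IsRefinable hA.equiv V) {σ : Rd d → ℝ} (hσ : IsSpectralFunction V σ) :
    ∀ᵐ ξ, Monotone fun j : ℤ => σ ((hA.adjointEquiv ^ (-j)) ξ) := by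
  have h : ∀ᵐ ξ, ∀ j : ℤ, σ ((hA.adjointEquiv ^ (-j)) ξ) ≤
      σ (hA.adjointEquiv.symm ((hA.adjointEquiv ^ (-j)) ξ)) :=
    ae_all_iff.mpr fun j => (quasiMeasurePreserving_equiv (hA.adjointEquiv ^ (-j))).ae
      (hσ.ae_le_comp_inv hA hV hAV)
  filter_upwards [h] with ξ hξ
  refine monotone_int_of_le_succ fun j => (hξ j).trans_eq ?_
  rw [neg_add_rev, zpow_add, zpow_neg_one]
  rfl

theorem IsSpectralFunction.ae_mem_Icc (hV : IsShiftInvariant V) {σ : Rd d → ℝ}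
    (hσ : IsSpectralFunction V σ) :
    ∀ᵐ ξ, ∀ j : ℤ, σ ((hA.adjointEquiv ^ (-j)) ξ) ∈ Set.Icc (0 : ℝ) 1 :=
  ae_all_iff.mpr fun j => (quasiMeasurePreserving_equiv (hA.adjointEquiv ^ (-j))).ae
    (hσ.ae_nonneg.and (hσ.ae_le_one hV))

/-! ### Completeness and averages of the spectral function -/

/-- The distance from 𝒟⁻ʲf to V is the distance from f to 𝒟ʲV; it decreases in j, and density makes
it tend to 0. -/
theorem HasCompletenessProperty.tendsto_norm_projection {B : Rd d ≃ₗ[ℝ] Rd d}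
    (hBV : IsRefinable B V) (hc : HasCompletenessProperty B V) (f : L2 d) :
    Tendsto (fun j : ℕ => ‖V.starProjection (dilation (B ^ (-(j : ℤ))) f)‖ ^ 2) atTop
      (𝓝 (‖f‖ ^ 2)) := by
  have hanti : Antitone fun j : ℤ =>
      ‖dilation (B ^ (-j)) f - V.starProjection (dilation (B ^ (-j)) f)‖ := by
    refine antitone_int_of_succ_le fun j => ?_
    have h := hBV.norm_sub_projection_le (dilation (B ^ (-j)) f)
    have h2 : dilation (B ^ (-(j + 1))) f = dilation B⁻¹ (dilation (B ^ (-j)) f) := by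
      rw [neg_add, zpow_add, zpow_neg_one, dilation_mul]
      rfl
    rwa [h2]
  have hr : Tendsto (fun j : ℕ => ‖dilation (B ^ (-(j : ℤ))) f -
      V.starProjection (dilation (B ^ (-(j : ℤ))) f)‖) atTop (𝓝 0) := by
    rw [Metric.tendsto_atTop]
    intro ε hε
    have hf : f ∈ closure (⋃ j : ℤ, (dilation B ^ j) '' (V : Set (L2 d))) := by
      rw [hc]
      trivial
    obtain ⟨g, hg, hfg⟩ := Metric.mem_closure_iff.mp hf ε hε
    obtain ⟨i, v, hv, rfl⟩ := Set.mem_iUnion.mp hg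
    -- The approximant may live at a negative scale i; monotonicity over ℤ still covers every
    -- natural j ≥ i.
    refine ⟨i.toNat, fun j hj => ?_⟩
    rw [Real.dist_0_eq_abs, abs_norm]
    refine (hanti (show i ≤ (j : ℤ) by omega)).trans_lt ?_
    refine (norm_sub_starProjection_le _ hv).trans_lt ?_
    have h3 : v = dilation (B ^ (-i)) ((dilation B ^ i) v) := by
      rw [← dilation_zpow, zpow_neg]
      exact ((dilation (B ^ i)).left_inv v).symm
    calc ‖dilation (B ^ (-i)) f - v‖ = ‖f - (dilation B ^ i) v‖ := by
          conv_lhs => rw [h3]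
          rw [← map_sub, norm_dilation]
      _ < ε := by rwa [← dist_eq_norm]
  have h4 := (hr.pow 2).const_sub (‖f‖ ^ 2)
  simp only [ne_eq, OfNat.ofNat_ne_zero, not_false_eq_true, zero_pow, sub_zero] at h4
  refine h4.congr fun j => ?_
  rw [norm_starProjection_sq, norm_dilation]

/-! ### Averages over dilated sets -/

theorem measureReal_image (L : Rd d ≃ₗ[ℝ] Rd d) (E : Set (Rd d)) :
    volume.real (L '' E) = |LinearMap.det (L : Rd d →ₗ[ℝ] Rd d)| * volume.real E := by
  rw [measureReal_def, show L '' E = (L : Rd d →ₗ[ℝ] Rd d) '' E from rfl,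
    Measure.addHaar_image_linearMap, ENNReal.toReal_mul, ENNReal.toReal_ofReal (abs_nonneg _)]
  rfl

theorem setIntegral_image (L : Rd d ≃ₗ[ℝ] Rd d) (E : Set (Rd d)) (f : Rd d → ℝ) :
    ∫ ξ in L '' E, f ξ = |LinearMap.det (L : Rd d →ₗ[ℝ] Rd d)| * ∫ ξ in E, f (L ξ) := by
  have h : Measure.map L (volume : Measure (Rd d)) = _ :=
    Measure.map_linearMap_addHaar_eq_smul_addHaar volume (f := (L : Rd d →ₗ[ℝ] Rd d))
      L.isUnit_det'.ne_zero
  have h2 := (measurableEmbedding_linearEquiv L).setIntegral_map (μ := (volume : Measure (Rd d)))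
    f (L '' E)
  rw [Set.preimage_image_eq _ L.injective, h, Measure.restrict_smul, integral_smul_measure,
    ENNReal.toReal_ofReal (abs_nonneg _)] at h2
  rw [← h2, smul_eq_mul, ← mul_assoc, ← abs_mul, mul_inv_cancel₀ L.isUnit_det'.ne_zero, abs_one,
    one_mul]

theorem average_image (L : Rd d ≃ₗ[ℝ] Rd d) (E : Set (Rd d)) (f : Rd d → ℝ) :
    (volume.real (L '' E))⁻¹ * ∫ ξ in L '' E, f ξ = (volume.real E)⁻¹ * ∫ ξ in E, f (L ξ) := by
  have : |LinearMap.det (L : Rd d →ₗ[ℝ] Rd d)| ≠ 0 := abs_ne_zero.mpr L.isUnit_det'.ne_zero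
  rw [measureReal_image, setIntegral_image, mul_inv]
  field_simp

theorem IsExpansiveDilation.eventually_preimage_subset_unitBox (hd : 0 < d) {E : Set (Rd d)}
    (hE : Bornology.IsBounded E) :
    ∀ᶠ j : ℕ in atTop, (hA.adjointEquiv ^ (j : ℤ)) ⁻¹' E ⊆ unitBox 0 := by
  obtain ⟨R, hR0, hR⟩ := hE.exists_pos_norm_le
  obtain ⟨ε, hε, hball⟩ := Metric.mem_nhds_iff.mp (unitBox_mem_nhds (0 : Rd d))
  have hεR : 0 < ε / (2 * R) := by positivity
  filter_upwards [hA.eventually_norm_adjointEquiv_zpow_le hd hεR] with j hj ξ hξ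
  refine hball (mem_ball_zero_iff.mpr ?_)
  have h1 := hj ((hA.adjointEquiv ^ (j : ℤ)) ξ)
  have h2 : (hA.adjointEquiv ^ (-(j : ℤ))) ((hA.adjointEquiv ^ (j : ℤ)) ξ) = ξ := by
    rw [zpow_neg]
    exact (hA.adjointEquiv ^ (j : ℤ)).symm_apply_apply ξ
  rw [h2] at h1
  calc ‖ξ‖ ≤ ε / (2 * R) * ‖(hA.adjointEquiv ^ (j : ℤ)) ξ‖ := h1
    _ ≤ ε / (2 * R) * R := by gcongr; exact hR _ hξ
    _ = ε / 2 := by field_simp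
    _ < ε := by linarith

/-- Boundedness of E guarantees that A*⁻ʲE is eventually inside one unit box, where the mean is the
normalised energy ‖P 𝒟⁻ʲp_E‖² / |E|. -/
theorem HasCompletenessProperty.tendsto_average (hd : 0 < d) (hV : IsShiftInvariant V)
    (hAV : IsRefinable hA.equiv V) {σ : Rd d → ℝ} (hσ : IsSpectralFunction V σ)
    (hc : HasCompletenessProperty hA.equiv V) {E : Set (Rd d)} (hE : MeasurableSet E)
    (hb : Bornology.IsBounded E) (hpos : 0 < volume E) :
    Tendsto (fun j : ℕ => (volume.real ((hA.adjointEquiv ^ (-(j : ℤ))) '' E))⁻¹ *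
      ∫ ξ in (hA.adjointEquiv ^ (-(j : ℤ))) '' E, σ ξ) atTop (𝓝 1) := by
  simp_rw [average_image]
  have hfin : volume E ≠ ∞ := hb.measure_lt_top.ne
  have hE0 : volume.real E ≠ 0 := (ENNReal.toReal_pos hpos.ne' hfin).ne'
  have h := hc.tendsto_norm_projection hAV (packet hE hfin)
  rw [norm_packet_sq] at h
  have h2 := h.const_mul (volume.real E)⁻¹
  rw [inv_mul_cancel₀ hE0] at h2
  refine h2.congr' ?_
  filter_upwards [hA.eventually_preimage_subset_unitBox hd hb] with j hj
  congr 1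
  have h3 := hσ.norm_projection_dilation_packet hV (hA.equiv ^ (-(j : ℤ)))
    (hA.adjointEquiv ^ (j : ℤ)) (fun x y => by simpa using hA.inner_zpow (-(j : ℤ)) x y) hE hfin hj
  rw [symm_zpow] at h3
  rw [integral_eq_lintegral_of_nonneg_ae, ← h3, ENNReal.toReal_ofReal (by positivity)]
  · refine ae_restrict_of_ae ?_
    filter_upwards [hσ.ae_mem_Icc hA hV] with ξ hξ
    exact (hξ j).1
  · exact ((hσ.aemeasurable hV).comp_quasiMeasurePreserving
      (quasiMeasurePreserving_equiv _)).aestronglyMeasurable.restrict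

end Projection

/-! ### Generating sets -/

theorem Generates.exists_countable_subset {V : Submodule ℂ (L2 d)} {𝒢 : Set (L2 d)}
    (hg : Generates 𝒢 V) :
    ∃ 𝒢' ⊆ 𝒢, 𝒢'.Countable ∧ Generates 𝒢' V := by
  have : SecondCountableTopology (L2 d) := UniformSpace.secondCountable_of_separable (L2 d)
  obtain ⟨t, ht, htc, htd⟩ :=
    (TopologicalSpace.IsSeparable.of_separableSpace 𝒢).exists_countable_dense_subset
  refine ⟨t, ht, htc, le_antisymm ?_ ?_⟩
  · rw [← hg]
    refine Submodule.topologicalClosure_mono (Submodule.span_mono ?_)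
    rintro _ ⟨φ, hφ, k, rfl⟩
    exact ⟨φ, ht hφ, k, rfl⟩
  · rw [← hg]
    refine Submodule.topologicalClosure_minimal _ (Submodule.span_le.mpr ?_)
      (Submodule.isClosed_topologicalClosure _)
    rintro _ ⟨φ, hφ, k, rfl⟩
    refine map_mem_closure (shift k).continuous (htd hφ) fun ψ hψ => ?_
    exact Submodule.subset_span ⟨ψ, hψ, k, rfl⟩

theorem IsShiftInvariant.exists_countable_generates {V : Submodule ℂ (L2 d)}
    (hV : IsShiftInvariant V) :
    ∃ 𝒢 : Set (L2 d), 𝒢.Countable ∧ Generates 𝒢 V := by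
  have hg : Generates (V : Set (L2 d)) V := by
    refine le_antisymm (Submodule.topologicalClosure_minimal _ (Submodule.span_le.mpr ?_)
      hV.isClosed) ?_
    · rintro _ ⟨φ, hφ, k, rfl⟩
      exact hV.shift_mem φ hφ k
    · intro v hv
      exact Submodule.le_topologicalClosure _
        (Submodule.subset_span ⟨v, hv, 0, (shift_zero v).symm⟩)
  obtain ⟨t, _, htc, htg⟩ := hg.exists_countable_subset
  exact ⟨t, htc, htg⟩

/-! ### Pointwise limits of the spectral function along the dilates -/

section Limits

variable {V : Submodule ℂ (L2 d)} [V.HasOrthogonalProjection]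
  {A : Rd d →ₗ[ℝ] Rd d} (hA : IsExpansiveDilation A)

theorem IsSpectralFunction.aemeasurable_comp (hV : IsShiftInvariant V) {σ : Rd d → ℝ}
    (hσ : IsSpectralFunction V σ) (L : Rd d ≃ₗ[ℝ] Rd d) : AEMeasurable fun ξ => σ (L ξ) :=
  (hσ.aemeasurable hV).comp_quasiMeasurePreserving (quasiMeasurePreserving_equiv L)

theorem IsSpectralFunction.measure_forall_le_eq_zero (hV : IsShiftInvariant V)
    {σ : Rd d → ℝ} (hσ : IsSpectralFunction V σ)
    (h : ∀ E : Set (Rd d), MeasurableSet E → Bornology.IsBounded E → 0 < volume E →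
      Tendsto (fun j : ℕ => (volume.real ((hA.adjointEquiv ^ (-(j : ℤ))) '' E))⁻¹ *
        ∫ ξ in (hA.adjointEquiv ^ (-(j : ℤ))) '' E, σ ξ) atTop (𝓝 1))
    (R : ℝ) {a : ℝ} (ha : a < 1) :
    volume (Metric.ball (0 : Rd d) R ∩
      {ξ | ∀ j : ℕ, σ ((hA.adjointEquiv ^ (-(j : ℤ))) ξ) ≤ a}) = 0 := by
  by_contra hne
  have hN : NullMeasurableSet (Metric.ball (0 : Rd d) R ∩
      {ξ | ∀ j : ℕ, σ ((hA.adjointEquiv ^ (-(j : ℤ))) ξ) ≤ a}) := by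
    refine Metric.isOpen_ball.measurableSet.nullMeasurableSet.inter ?_
    rw [Set.ofPred_forall]
    exact NullMeasurableSet.iInter fun j =>
      nullMeasurableSet_le (hσ.aemeasurable_comp hV _) aemeasurable_const
  obtain ⟨E, hEN, hE, hEae⟩ := hN.exists_measurable_subset_ae_eq
  rw [← measure_congr hEae] at hne
  have hb : Bornology.IsBounded E :=
    Metric.isBounded_ball.subset (hEN.trans Set.inter_subset_left)
  have hpos : 0 < volume E := pos_iff_ne_zero.mpr hne
  have hfin : volume E ≠ ∞ := hb.measure_lt_top.ne
  have hE0 : 0 < volume.real E := ENNReal.toReal_pos hne hfin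
  have hlim := h E hE hb hpos
  simp_rw [average_image] at hlim
  -- On E the whole forward orbit stays at or below a, so every mean is at most a < 1, against the
  -- limit 1.
  refine absurd (le_of_tendsto' hlim fun j => ?_) (not_le.mpr ha)
  have hint : IntegrableOn (fun ξ => σ ((hA.adjointEquiv ^ (-(j : ℤ))) ξ)) E := by
    refine Measure.integrableOn_of_bounded (M := 1) hfin
      (hσ.aemeasurable_comp hV _).aestronglyMeasurable (ae_restrict_of_ae ?_)
    filter_upwards [hσ.ae_mem_Icc hA hV] with ξ hξ
    rw [Real.norm_of_nonneg (hξ j).1]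
    exact (hξ j).2
  have hle : ∫ ξ in E, σ ((hA.adjointEquiv ^ (-(j : ℤ))) ξ) ≤ ∫ _ξ in E, a :=
    setIntegral_mono_on hint (integrableOn_const hfin) hE fun ξ hξ => (hEN hξ).2 j
  rw [setIntegral_const, smul_eq_mul] at hle
  calc _ ≤ (volume.real E)⁻¹ * (volume.real E * a) := by gcongr
    _ = a := by field_simp

/-- Outside a countable union of null sets, each orbit exceeds 1 - 1/(m+1) at some time, for every
m; monotonicity and the bound by 1 turn this into convergence. -/
theorem IsSpectralFunction.ae_tendsto_one (hV : IsShiftInvariant V)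
    (hAV : IsRefinable hA.equiv V) {σ : Rd d → ℝ} (hσ : IsSpectralFunction V σ)
    (h : ∀ E : Set (Rd d), MeasurableSet E → Bornology.IsBounded E → 0 < volume E →
      Tendsto (fun j : ℕ => (volume.real ((hA.adjointEquiv ^ (-(j : ℤ))) '' E))⁻¹ *
        ∫ ξ in (hA.adjointEquiv ^ (-(j : ℤ))) '' E, σ ξ) atTop (𝓝 1)) :
    ∀ᵐ ξ : Rd d, Tendsto (fun j : ℕ => σ ((hA.adjointEquiv ^ (-(j : ℤ))) ξ)) atTop (𝓝 1) := by
  have h1 : ∀ᵐ ξ : Rd d, ∀ n m : ℕ, ¬ (ξ ∈ Metric.ball (0 : Rd d) n ∧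
      ∀ j : ℕ, σ ((hA.adjointEquiv ^ (-(j : ℤ))) ξ) ≤ 1 - 1 / ((m : ℝ) + 1)) := by
    rw [ae_all_iff]
    intro n
    rw [ae_all_iff]
    intro m
    have hm : 1 - 1 / ((m : ℝ) + 1) < 1 := by
      have : 0 < 1 / ((m : ℝ) + 1) := by positivity
      linarith
    exact measure_eq_zero_iff_ae_notMem.mp (hσ.measure_forall_le_eq_zero hA hV h n hm)
  filter_upwards [h1, hσ.ae_monotone hA hV hAV, hσ.ae_mem_Icc hA hV] with ξ h1 h2 h3
  rw [Metric.tendsto_atTop]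
  intro ε hε
  obtain ⟨n, hn⟩ := exists_nat_gt ‖ξ‖
  obtain ⟨m, hm⟩ := exists_nat_one_div_lt hε
  have h4 := h1 n m
  rw [not_and, not_forall] at h4
  obtain ⟨j₀, hj₀⟩ := h4 (mem_ball_zero_iff.mpr hn)
  refine ⟨j₀, fun j hj => ?_⟩
  have h5 : σ ((hA.adjointEquiv ^ (-(j₀ : ℤ))) ξ) ≤ σ ((hA.adjointEquiv ^ (-(j : ℤ))) ξ) :=
    h2 (by exact_mod_cast hj)
  have h6 := (h3 j).2
  rw [Real.dist_eq, abs_sub_lt_iff]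
  constructor <;> linarith

theorem isAbsorbing_of_ae_tendsto_pos {σ : Rd d → ℝ}
    (h : ∀ᵐ ξ : Rd d, ∃ L : ℝ, 0 < L ∧
      Tendsto (fun j : ℕ => σ ((hA.adjointEquiv ^ (-(j : ℤ))) ξ)) atTop (𝓝 L)) :
    IsAbsorbing hA.adjointEquiv⁻¹ (Function.support σ) := by
  filter_upwards [h] with ξ ⟨L, hL, hlim⟩
  obtain ⟨j₀, hj₀⟩ := eventually_atTop.mp (hlim.eventually_const_lt hL)
  refine ⟨j₀, fun j hj => ?_⟩
  have := hj₀ j hj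
  rw [inv_pow, ← zpow_natCast, ← zpow_neg]
  exact this.ne'

/-! ### Supports of generators -/

theorem IsSpectralFunction.ae_exists_fourier_ne_zero (hV : IsShiftInvariant V) {σ : Rd d → ℝ}
    (hσ : IsSpectralFunction V σ) {𝒢 : Set (L2 d)} (hc : 𝒢.Countable) (hg : Generates 𝒢 V) :
    ∀ᵐ ξ : Rd d, σ ξ ≠ 0 → ∃ φ ∈ 𝒢, (𝓕 φ : L2 d) ξ ≠ 0 := by
  have hN : NullMeasurableSet {ξ : Rd d | ∀ φ ∈ 𝒢, (𝓕 φ : L2 d) ξ = 0} := by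
    have : {ξ : Rd d | ∀ φ ∈ 𝒢, (𝓕 φ : L2 d) ξ = 0} =
        ⋂ φ ∈ 𝒢, {ξ : Rd d | (𝓕 φ : L2 d) ξ = 0} := by
      ext ξ
      simp
    rw [this]
    exact NullMeasurableSet.biInter hc fun φ _ => nullMeasurableSet_eq_fun
      (Lp.aestronglyMeasurable (𝓕 φ : L2 d)).aemeasurable aemeasurable_const
  obtain ⟨N, hNsub, hNm, hNae⟩ := hN.exists_measurable_subset_ae_eq
  have hzero : ∀ᵐ ξ, N.indicator (fun ξ => ENNReal.ofReal (σ ξ)) ξ ≤ (fun _ => 0) ξ := by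
    refine ae_le_of_locally_setLIntegral_le
      ((hσ.aemeasurable hV).ennreal_ofReal.indicator hNm) fun x =>
        ⟨unitBox x, unitBox_mem_nhds x, fun E hE hEx => ?_⟩
    have hEx' : N ∩ E ⊆ unitBox x := Set.inter_subset_right.trans hEx
    have hEm : MeasurableSet (N ∩ E) := hNm.inter hE
    have hne := volume_ne_top_of_subset_unitBox hEx'
    rw [lintegral_indicator hNm, Measure.restrict_restrict hNm, hσ.setLIntegral_eq hV hEm hEx']
    -- The Fourier transforms of all translates of generators vanish on N, so the packet is
    -- orthogonal to a dense part of V, and its projected energy, the integral of σ, is zero.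
    have horth : packet hEm hne ∈ Vᗮ := by
      rw [← hg, Submodule.orthogonal_closure, Submodule.mem_orthogonal']
      intro u hu
      refine Submodule.span_induction ?_ ?_ ?_ ?_ hu
      · rintro _ ⟨φ, hφ, k, rfl⟩
        rw [inner_packet_shift]
        refine setIntegral_eq_zero_of_forall_eq_zero fun ξ hξ => ?_
        rw [hNsub hξ.1 φ hφ, mul_zero]
      · exact inner_zero_right _
      · intro u v _ _ h1 h2
        rw [inner_add_right, h1, h2, add_zero]
      · intro c u _ h1
        rw [inner_smul_right, h1, mul_zero]
    rw [V.starProjection_apply_eq_zero_iff.mpr horth]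
    simp
  filter_upwards [hzero, hNae.mem_iff, hσ.ae_nonneg] with ξ h1 h2 h3 h4
  by_contra hcon
  push Not at hcon
  have hξ : ξ ∈ N := h2.mpr hcon
  rw [Set.indicator_of_mem hξ] at h1
  exact h4 (le_antisymm (by simpa using h1) h3)

/-- An arbitrary generating set is cut down to a countable one, so that the exceptional null sets
can be united. -/
theorem IsSpectralFunction.ae_mem_dilatedFourierSupports (hV : IsShiftInvariant V)
    {σ : Rd d → ℝ} (hσ : IsSpectralFunction V σ)
    (h : ∀ᵐ ξ : Rd d, ∃ j : ℕ, σ ((hA.adjointEquiv ^ (-(j : ℤ))) ξ) ≠ 0)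
    {𝒢 : Set (L2 d)} (hg : Generates 𝒢 V) :
    ∀ᵐ ξ : Rd d, ξ ∈ dilatedFourierSupports hA.adjointEquiv 𝒢 := by
  obtain ⟨t, ht, htc, htg⟩ := hg.exists_countable_subset
  have h1 : ∀ᵐ ξ : Rd d, ∀ j : ℕ, σ ((hA.adjointEquiv ^ (-(j : ℤ))) ξ) ≠ 0 →
      ∃ φ ∈ t, (𝓕 φ : L2 d) ((hA.adjointEquiv ^ (-(j : ℤ))) ξ) ≠ 0 :=
    ae_all_iff.mpr fun j => (quasiMeasurePreserving_equiv _).ae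
      (hσ.ae_exists_fourier_ne_zero hV htc htg)
  filter_upwards [h, h1] with ξ ⟨j, hj⟩ h1
  obtain ⟨φ, hφ, hne⟩ := h1 j hj
  refine Set.mem_biUnion (ht hφ) (Set.mem_iUnion.mpr ⟨j, _, hne, ?_⟩)
  rw [zpow_neg]
  exact (hA.adjointEquiv ^ (j : ℤ)).apply_symm_apply ξ

end Limits

/-! ### Completeness from the supports of generators -/

theorem ae_eq_zero_of_fourier_eq_zero {h : Rd d → ℂ} (hh : Integrable h)
    (h0 : ∀ y, 𝓕 h y = 0) : ∀ᵐ ξ, h ξ = 0 := by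
  refine ae_eq_zero_of_integral_contDiff_smul_eq_zero hh.locallyIntegrable fun g hg hgc => ?_
  have hgc' : HasCompactSupport fun x => (g x : ℂ) := hgc.comp_left Complex.ofReal_zero
  have hg' : ContDiff ℝ (↑(⊤ : ℕ∞)) fun x => (g x : ℂ) := Complex.ofRealCLM.contDiff.comp hg
  set ψ : SchwartzMap (Rd d) ℂ := hgc'.toSchwartzMap hg' with hψ
  set θ : SchwartzMap (Rd d) ℂ := 𝓕⁻ ψ with hθ
  -- The multiplication formula moves the Fourier transform from h to θ. As the test function is the
  -- Fourier transform of θ, its integral against h is zero.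
  have h1 := VectorFourier.integral_fourierIntegral_smul_eq_flip (L := innerₗ (Rd d))
    (μ := (volume : Measure (Rd d))) (ν := (volume : Measure (Rd d)))
    Real.continuous_fourierChar continuous_inner hh (θ.integrable (μ := volume))
  rw [flip_innerₗ] at h1
  have h2 : ∀ x, VectorFourier.fourierIntegral Real.fourierChar volume (innerₗ (Rd d)) θ x
      = (g x : ℂ) := by
    intro x
    have h3 : 𝓕 θ = ψ := FourierTransform.fourier_fourierInv_eq ψ
    have h4 : (𝓕 θ) x = (g x : ℂ) := by rw [h3]; rfl
    rw [← h4]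
    rfl
  have h5 : ∀ x, VectorFourier.fourierIntegral Real.fourierChar volume (innerₗ (Rd d)) h x = 0 := h0
  simp_rw [h2, h5, zero_smul, integral_zero] at h1
  rw [h1]
  refine integral_congr_ae (Eventually.of_forall fun x => ?_)
  simp only [smul_eq_mul, Complex.real_smul]
  ring

theorem inner_modulation_eq_fourier (f g : L2 d) (y : Rd d) :
    inner ℂ f (modulation y g) = 𝓕 (fun ξ => inner ℂ (f ξ) (g ξ)) y := by
  rw [L2.inner_def, Real.fourier_eq]
  refine integral_congr_ae ?_
  filter_upwards [coeFn_modulation y g] with ξ hξ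
  rw [hξ, real_inner_comm ξ y, ← smul_eq_mul, inner_smul_right]
  rfl

theorem continuous_fourier_inner (f g : L2 d) :
    Continuous (𝓕 fun ξ => inner ℂ (f ξ) (g ξ) : Rd d → ℂ) :=
  VectorFourier.fourierIntegral_continuous Real.continuous_fourierChar continuous_inner
    (L2.integrable_inner f g)

theorem dilation_modulation (C : Rd d ≃ₗ[ℝ] Rd d) {y z : Rd d}
    (h : ∀ ξ, inner ℝ y (C ξ) = inner ℝ z ξ) (f : L2 d) :
    dilation C (modulation y f) = modulation z (dilation C f) := by
  apply Lp.ext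
  refine (coeFn_dilationFun C _).trans ?_
  filter_upwards [(quasiMeasurePreserving_equiv C).ae (coeFn_modulation y f),
    coeFn_modulation z (dilation C f), coeFn_dilationFun C f] with ξ h1 h2 h3
  have h4 : dilation C f ξ = _ := h3
  rw [h1, h2, h4, h]
  ring

section

variable {A : Rd d →ₗ[ℝ] Rd d} (hA : IsExpansiveDilation A)

/-- Conjugating translation by k with 𝒟ʲ gives translation by A⁻ʲk, hence modulation by that point
on the Fourier side. -/
theorem IsExpansiveDilation.fourier_dilation_shift (j : ℤ) (k : Fin d → ℤ) (w : L2 d) :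
    𝓕 (dilation (hA.equiv ^ j) (shift k (dilation (hA.equiv ^ (-j)) w))) =
      modulation ((hA.equiv ^ (-j)) (latticePoint k)) (𝓕 w) := by
  have h1 : dilation (hA.adjointEquiv ^ (-j)) (dilation (hA.adjointEquiv ^ j) (𝓕 w)) = 𝓕 w := by
    rw [zpow_neg]
    exact (dilation (hA.adjointEquiv ^ j)).left_inv _
  rw [fourier_dilation _ (hA.adjointEquiv ^ (-j)) (hA.inner_zpow j), fourier_shift,
    fourier_dilation _ (hA.adjointEquiv ^ j) fun x y => by simpa using hA.inner_zpow (-j) x y,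
    dilation_modulation (z := (hA.equiv ^ (-j)) (latticePoint k)), h1]
  intro ξ
  rw [← hA.inner_zpow j ((hA.equiv ^ (-j)) (latticePoint k)) ξ]
  congr 1
  rw [zpow_neg]
  exact ((hA.equiv ^ j).apply_symm_apply _).symm

/-- Rounding Aʲx to a lattice point makes a bounded error, which A⁻ʲ shrinks. The restriction j ≥ i
keeps only the scales for which 𝒟ⁱV ⊆ 𝒟ʲV. -/
theorem IsExpansiveDilation.dense_lattice (hd : 0 < d) (i : ℤ) :
    Dense {y : Rd d | ∃ j ≥ i, ∃ k : Fin d → ℤ, y = (hA.equiv ^ (-j)) (latticePoint k)} := by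
  intro x
  rw [Metric.mem_closure_iff]
  intro ε hε
  obtain ⟨R, hR0, hR⟩ := (isBounded_unitBox (0 : Rd d)).exists_pos_norm_le
  have hεR : 0 < ε / (2 * R) := by positivity
  obtain ⟨j, hj, hji⟩ := ((hA.eventually_norm_equiv_zpow_le hd hεR).and
    (eventually_ge_atTop i.toNat)).exists
  set z := (hA.equiv ^ (j : ℤ)) x with hz
  have hzk : ∃ k : Fin d → ℤ, z ∈ unitBox (latticePoint k) := by
    rw [← Set.mem_iUnion, iUnion_unitBox_latticePoint]
    trivial
  obtain ⟨k, hk⟩ := hzk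
  refine ⟨_, ⟨j, by omega, k, rfl⟩, ?_⟩
  have hx : (hA.equiv ^ (-(j : ℤ))) z = x := by
    rw [hz, zpow_neg]
    exact (hA.equiv ^ (j : ℤ)).symm_apply_apply x
  have hzk : z - latticePoint k ∈ unitBox (0 : Rd d) := by
    intro l
    have := hk l
    simp only [Set.mem_Ioc, PiLp.sub_apply, PiLp.zero_apply] at this ⊢
    constructor <;> linarith [this.1, this.2]
  rw [dist_eq_norm]
  nth_rewrite 1 [← hx]
  rw [← map_sub]
  calc _ ≤ ε / (2 * R) * ‖z - latticePoint k‖ := hj _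
    _ ≤ ε / (2 * R) * R := by gcongr; exact hR _ hzk
    _ = ε / 2 := by field_simp
    _ < ε := by linarith

variable {V : Submodule ℂ (L2 d)}

theorem IsRefinable.monotone_map {B : Rd d ≃ₗ[ℝ] Rd d} (hBV : IsRefinable B V) :
    Monotone fun j : ℤ => V.map (dilation (B ^ j)).toLinearMap := by
  refine monotone_int_of_le_succ fun j => ?_
  rintro _ ⟨v, hv, rfl⟩
  obtain ⟨u, hu, rfl⟩ := hBV hv
  refine ⟨u, hu, ?_⟩
  rw [add_comm, zpow_add, zpow_one, dilation_mul]
  rfl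

/-- A function orthogonal to all `𝒟^j V` has a Fourier transform that vanishes wherever the
Fourier transform of an element of some `𝒟^j V` does not. -/
theorem IsExpansiveDilation.ae_inner_fourier_eq_zero (hd : 0 < d) (hV : IsShiftInvariant V)
    (hAV : IsRefinable hA.equiv V) {f : L2 d}
    (hf : ∀ j : ℤ, ∀ v ∈ V, inner ℂ f (dilation (hA.equiv ^ j) v) = 0) (i : ℤ) {v : L2 d}
    (hv : v ∈ V) :
    ∀ᵐ ξ, inner ℂ ((𝓕 f : L2 d) ξ) ((𝓕 (dilation (hA.equiv ^ i) v) : L2 d) ξ) = 0 := by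
  refine ae_eq_zero_of_fourier_eq_zero (L2.integrable_inner _ _) ?_
  refine (hA.dense_lattice hd i).induction ?_
    (isClosed_eq (continuous_fourier_inner _ _) continuous_const)
  -- At y = A⁻ʲk the Fourier transform is the inner product of f with the translate by y of 𝒟ⁱv. By
  -- nesting, 𝒟ⁱv is in 𝒟ʲV, which that translation preserves.
  rintro _ ⟨j, hij, k, rfl⟩
  rw [← inner_modulation_eq_fourier, ← hA.fourier_dilation_shift, Lp.inner_fourier_eq]
  refine hf j _ (hV.shift_mem _ ?_ k)
  obtain ⟨u, hu, hu2⟩ := hAV.monotone_map hij ⟨v, hv, rfl⟩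
  have h1 : dilation (hA.equiv ^ (-j)) (dilation (hA.equiv ^ i) v) = u := by
    have h2 : dilation (hA.equiv ^ j) u = dilation (hA.equiv ^ i) v := hu2
    rw [← h2, zpow_neg]
    exact (dilation (hA.equiv ^ j)).left_inv u
  rw [h1]
  exact hu

theorem hasCompletenessProperty_of_ae_mem_dilatedFourierSupports (hd : 0 < d)
    (hV : IsShiftInvariant V) (hAV : IsRefinable hA.equiv V) {𝒢 : Set (L2 d)}
    (hc : 𝒢.Countable) (hg : Generates 𝒢 V)
    (h : ∀ᵐ ξ : Rd d, ξ ∈ dilatedFourierSupports hA.adjointEquiv 𝒢) :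
    HasCompletenessProperty hA.equiv V := by
  have hgV : ∀ φ ∈ 𝒢, φ ∈ V := by
    intro φ hφ
    rw [← hg]
    exact Submodule.le_topologicalClosure _
      (Submodule.subset_span ⟨φ, hφ, 0, (shift_zero φ).symm⟩)
  -- The spaces are nested, so their union is itself a subspace, and density means trivial
  -- orthogonal complement.
  have hcoe := Submodule.coe_iSup_of_directed _ hAV.monotone_map.directed_le
  have horth : (⨆ j : ℤ, V.map (dilation (hA.equiv ^ j)).toLinearMap)ᗮ = ⊥ := by
    rw [eq_bot_iff]
    intro f hf
    rw [Submodule.mem_orthogonal'] at hf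
    have hf' : ∀ j : ℤ, ∀ v ∈ V, inner ℂ f (dilation (hA.equiv ^ j) v) = 0 := fun j v hv =>
      hf _ (Submodule.mem_iSup_of_mem j ⟨v, hv, rfl⟩)
    have h1 : ∀ᵐ ξ : Rd d, ∀ φ ∈ 𝒢, ∀ j : ℤ,
        (𝓕 f : L2 d) ξ = 0 ∨ (𝓕 φ : L2 d) ((hA.adjointEquiv ^ (-j)) ξ) = 0 := by
      rw [ae_ball_iff hc]
      intro φ hφ
      rw [ae_all_iff]
      intro j
      have h2 := hA.ae_inner_fourier_eq_zero hd hV hAV hf' j (hgV φ hφ)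
      rw [fourier_dilation _ (hA.adjointEquiv ^ (-j)) (hA.inner_zpow j)] at h2
      filter_upwards [h2, coeFn_dilationFun (hA.adjointEquiv ^ (-j)) (𝓕 φ)] with ξ h3 h4
      have h5 : dilation (hA.adjointEquiv ^ (-j)) (𝓕 φ) ξ = _ := h4
      have hdet : Real.sqrt |LinearMap.det
          ((hA.adjointEquiv ^ (-j) : Rd d ≃ₗ[ℝ] Rd d) : Rd d →ₗ[ℝ] Rd d)| ≠ 0 :=
        (Real.sqrt_pos.mpr (abs_pos.mpr (hA.adjointEquiv ^ (-j)).isUnit_det'.ne_zero)).ne'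
      rw [h5] at h3
      simp only [RCLike.inner_apply, mul_eq_zero, map_eq_zero, Complex.ofReal_eq_zero,
        or_iff_right hdet] at h3
      exact h3.symm
    have h6 : (𝓕 f : L2 d) = 0 := by
      apply Lp.ext
      filter_upwards [h, h1, Lp.coeFn_zero ℂ 2 (volume : Measure (Rd d))] with ξ h2 h3 h4
      rw [h4]
      simp only [dilatedFourierSupports, Set.mem_iUnion] at h2
      obtain ⟨φ, hφ, j, η, hη, rfl⟩ := h2
      refine (h3 φ hφ j).resolve_right ?_
      have h5 : (hA.adjointEquiv ^ (-j)) ((hA.adjointEquiv ^ j) η) = η := by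
        rw [zpow_neg]
        exact (hA.adjointEquiv ^ j).symm_apply_apply η
      rw [h5]
      exact hη
    rw [Submodule.mem_bot, ← norm_eq_zero, ← Lp.norm_fourier_eq, h6, norm_zero]
  rw [← Submodule.topologicalClosure_eq_top_iff] at horth
  have h7 := congrArg (fun S : Submodule ℂ (L2 d) => (S : Set (L2 d))) horth
  simp only [Submodule.topologicalClosure_coe, hcoe, Submodule.top_coe] at h7
  rw [HasCompletenessProperty, ← h7]
  simp_rw [← dilation_zpow]
  rfl

end

/-! ### Density at the origin -/

theorem measureReal_inter_image_div (L : Rd d ≃ₗ[ℝ] Rd d) (S K : Set (Rd d)) :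
    volume.real (S ∩ L '' K) / volume.real (L '' K) =
      volume.real (K ∩ L ⁻¹' S) / volume.real K := by
  have h : S ∩ L '' K = L '' (K ∩ L ⁻¹' S) := by rw [Set.image_inter_preimage, Set.inter_comm]
  have : |LinearMap.det (L : Rd d →ₗ[ℝ] Rd d)| ≠ 0 := abs_ne_zero.mpr L.isUnit_det'.ne_zero
  rw [h, measureReal_image, measureReal_image, mul_div_mul_left _ _ this]

theorem measureReal_ball_pos {r : ℝ} (hr : 0 < r) : 0 < volume.real (Metric.ball (0 : Rd d) r) :=
  ENNReal.toReal_pos (Metric.measure_ball_pos volume _ hr).ne' measure_ball_lt_top.ne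

section

variable {A : Rd d →ₗ[ℝ] Rd d} (hA : IsExpansiveDilation A)

theorem IsExpansiveDilation.tendsto_adjointEquiv_zpow (hd : 0 < d) (ξ : Rd d) :
    Tendsto (fun j : ℕ => (hA.adjointEquiv ^ (-(j : ℤ))) ξ) atTop (𝓝 0) := by
  rw [Metric.tendsto_atTop]
  intro ε hε
  have hpos : 0 < ε / (‖ξ‖ + 1) := by positivity
  obtain ⟨N, hN⟩ := eventually_atTop.mp (hA.eventually_norm_adjointEquiv_zpow_le hd hpos)
  refine ⟨N, fun j hj => ?_⟩
  rw [dist_zero_right]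
  calc _ ≤ ε / (‖ξ‖ + 1) * ‖ξ‖ := hN j hj ξ
    _ < ε / (‖ξ‖ + 1) * (‖ξ‖ + 1) := by gcongr; linarith
    _ = ε := by field_simp

/-- Let N be the points of the unit ball whose forward orbit consists of zeros of σ. At every scale
j its share of the ball is at most the share of zeros in A*⁻ʲB₁, which tends to 0; so N is null.
Almost every orbit enters the ball outside N. -/
theorem IsLocallyNonzero.ae_exists_ne_zero (hd : 0 < d) {σ : Rd d → ℝ}
    (h : IsLocallyNonzero hA.adjointEquiv σ) :
    ∀ᵐ ξ : Rd d, ∃ j : ℕ, σ ((hA.adjointEquiv ^ (-(j : ℤ))) ξ) ≠ 0 := by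
  set N : Set (Rd d) := Metric.ball 0 1 ∩
    {ξ | ∀ j : ℕ, σ ((hA.adjointEquiv ^ (-(j : ℤ))) ξ) = 0} with hN
  have hfin : volume (Metric.ball (0 : Rd d) 1) ≠ ∞ := measure_ball_lt_top.ne
  have hNfin : volume N ≠ ∞ := measure_ne_top_of_subset Set.inter_subset_left hfin
  have hle : ∀ j : ℕ, volume.real N / volume.real (Metric.ball (0 : Rd d) 1) ≤
      volume.real {x ∈ (hA.adjointEquiv ^ (-(j : ℤ))) '' Metric.ball (0 : Rd d) 1 | σ x = 0} /
        volume.real ((hA.adjointEquiv ^ (-(j : ℤ))) '' Metric.ball (0 : Rd d) 1) := by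
    intro j
    have h1 : {x ∈ (hA.adjointEquiv ^ (-(j : ℤ))) '' Metric.ball (0 : Rd d) 1 | σ x = 0} =
        {x | σ x = 0} ∩ (hA.adjointEquiv ^ (-(j : ℤ))) '' Metric.ball (0 : Rd d) 1 := by
      ext x
      exact and_comm
    rw [h1, measureReal_inter_image_div]
    refine div_le_div_of_nonneg_right (measureReal_mono (fun ξ hξ => ⟨hξ.1, hξ.2 j⟩) ?_)
      measureReal_nonneg
    exact measure_ne_top_of_subset Set.inter_subset_left hfin
  have h0 : volume.real N / volume.real (Metric.ball (0 : Rd d) 1) ≤ 0 := ge_of_tendsto' h hle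
  have hN0 : volume N = 0 := by
    have h2 : volume.real N ≤ 0 := by
      by_contra hcon
      exact absurd (div_pos (not_le.mp hcon) (measureReal_ball_pos one_pos)) (not_lt.mpr h0)
    exact (measureReal_eq_zero_iff hNfin).mp (le_antisymm h2 measureReal_nonneg)
  have h3 : ∀ᵐ ξ : Rd d, ∀ i : ℕ, (hA.adjointEquiv ^ (-(i : ℤ))) ξ ∉ N :=
    ae_all_iff.mpr fun i => (quasiMeasurePreserving_equiv _).ae
      (measure_eq_zero_iff_ae_notMem.mp hN0)
  filter_upwards [h3] with ξ hξ
  obtain ⟨i, hi⟩ := ((hA.tendsto_adjointEquiv_zpow hd ξ).eventually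
    (Metric.ball_mem_nhds 0 one_pos)).exists
  obtain ⟨j, hj⟩ := not_forall.mp fun hcon => hξ i ⟨hi, hcon⟩
  refine ⟨j + i, ?_⟩
  have h5 : (hA.adjointEquiv ^ (-((j + i : ℕ) : ℤ))) ξ =
      (hA.adjointEquiv ^ (-(j : ℤ))) ((hA.adjointEquiv ^ (-(i : ℤ))) ξ) := by
    rw [Nat.cast_add, neg_add, zpow_add]
    rfl
  rw [h5]
  exact hj

theorem IsExpansiveDilation.eventually_image_ball_subset (hd : 0 < d) {ε : ℝ} (hε : 0 < ε) :
    ∀ᶠ j : ℕ in atTop, (hA.adjointEquiv ^ (-(j : ℤ))) '' Metric.ball (0 : Rd d) 1 ⊆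
      Metric.ball 0 ε := by
  filter_upwards [hA.eventually_norm_adjointEquiv_zpow_le hd hε] with j hj
  rintro _ ⟨ξ, hξ, rfl⟩
  rw [mem_ball_zero_iff] at hξ ⊢
  calc _ ≤ ε * ‖ξ‖ := hj ξ
    _ < ε * 1 := by gcongr
    _ = ε := mul_one ε

theorem IsApproxContinuous.isLocallyNonzero (hd : 0 < d) {σ : Rd d → ℝ}
    (h : IsApproxContinuous hA.adjointEquiv (Function.update σ 0 1)) :
    IsLocallyNonzero hA.adjointEquiv σ := by
  have : Nonempty (Fin d) := ⟨⟨0, hd⟩⟩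
  obtain ⟨S, hS, -, hdens, hlim⟩ := h
  have h1 := (hdens 1 one_pos).const_sub 1
  rw [sub_self] at h1
  rw [Function.update_self] at hlim
  have h2 : ∀ᶠ x in 𝓝[S] (0 : Rd d), 0 < Function.update σ 0 1 x :=
    hlim.eventually_const_lt one_pos
  rw [eventually_nhdsWithin_iff] at h2
  obtain ⟨ε, hε, hball⟩ := Metric.eventually_nhds_iff_ball.mp h2
  refine squeeze_zero' (Eventually.of_forall fun j => by positivity) ?_ h1
  filter_upwards [hA.eventually_image_ball_subset hd hε] with j hj
  set K := (hA.adjointEquiv ^ (-(j : ℤ))) '' Metric.ball (0 : Rd d) 1 with hK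
  have hKfin : volume K ≠ ∞ := (Metric.isBounded_ball.subset hj).measure_lt_top.ne
  have hKpos : 0 < volume.real K := by
    rw [hK, measureReal_image]
    exact mul_pos (abs_pos.mpr (hA.adjointEquiv ^ (-(j : ℤ))).isUnit_det'.ne_zero)
      (measureReal_ball_pos one_pos)
  -- The origin is set apart because only the updated function is controlled there; a single point
  -- is null as d > 0.
  have hsub : {x ∈ K | σ x = 0} ⊆ (K \ S) ∪ {0} := by
    rintro x ⟨hxK, hx0⟩
    by_cases hx : x = 0
    · exact Or.inr hx
    · refine Or.inl ⟨hxK, fun hxS => ?_⟩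
      have := hball x (hj hxK) hxS
      rw [Function.update_of_ne hx, hx0] at this
      exact lt_irrefl _ this
  have hmeas : volume.real {x ∈ K | σ x = 0} ≤ volume.real K - volume.real (S ∩ K) := by
    have h3 : volume.real ((K \ S) ∪ {0}) ≤ volume.real (K \ S) + volume.real ({0} : Set (Rd d)) :=
      measureReal_union_le _ _
    have h4 : volume.real ({0} : Set (Rd d)) = 0 := by simp [measureReal_def]
    have h5 := measureReal_inter_add_sdiff (μ := volume) (s := K) hS hKfin
    have h6 : volume.real {x ∈ K | σ x = 0} ≤ volume.real ((K \ S) ∪ {0}) := by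
      refine measureReal_mono hsub ?_
      refine ((measure_union_le _ _).trans_lt ?_).ne
      refine ENNReal.add_lt_top.mpr ⟨(measure_mono Set.sdiff_subset).trans_lt hKfin.lt_top, ?_⟩
      simp
    rw [Set.inter_comm S K]
    linarith
  calc _ ≤ (volume.real K - volume.real (S ∩ K)) / volume.real K := by gcongr
    _ = _ := by rw [sub_div, div_self hKpos.ne']

/-! ### From orbit convergence to approximate continuity -/

theorem tendsto_volume_ball_zero (hd : 0 < d) :
    Tendsto (fun ρ : ℝ => volume (Metric.ball (0 : Rd d) ρ)) (𝓝[>] 0) (𝓝 0) := by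
  have h1 : Tendsto (fun ρ : ℝ => ENNReal.ofReal (ρ ^ Module.finrank ℝ (Rd d)) *
      volume (Metric.ball (0 : Rd d) 1)) (𝓝[>] 0) (𝓝 0) := by
    have h2 : Tendsto (fun ρ : ℝ => ENNReal.ofReal (ρ ^ Module.finrank ℝ (Rd d))) (𝓝[>] 0)
        (𝓝 0) := by
      have hc : Continuous fun ρ : ℝ => ENNReal.ofReal (ρ ^ Module.finrank ℝ (Rd d)) :=
        ENNReal.continuous_ofReal.comp (by fun_prop)
      have h3 := (hc.tendsto 0).mono_left (nhdsWithin_le_nhds (s := Set.Ioi 0))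
      simpa [hd.ne'] using h3
    have h4 := ENNReal.Tendsto.mul_const (b := volume (Metric.ball (0 : Rd d) 1)) h2
      (Or.inr measure_ball_lt_top.ne)
    simpa using h4
  refine h1.congr' ?_
  filter_upwards [self_mem_nhdsWithin] with ρ hρ
  rw [Measure.addHaar_ball_of_pos volume _ hρ]

theorem tendsto_tsum_ennreal_of_dominated {F : ℕ → ℕ → ℝ≥0∞} (b : ℕ → ℝ≥0∞)
    (hb : ∑' n, b n ≠ ∞) (hF : ∀ j n, F j n ≤ b n)
    (hlim : ∀ n, Tendsto (fun j => F j n) atTop (𝓝 0)) :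
    Tendsto (fun j => ∑' n, F j n) atTop (𝓝 0) := by
  have h := tendsto_lintegral_of_dominated_convergence (μ := Measure.count) (F := F)
    (f := fun _ => 0) b (fun j => measurable_from_top) (fun j => Eventually.of_forall (hF j))
    (by rwa [lintegral_count]) (Eventually.of_forall hlim)
  simpa [lintegral_count] using h

/-- On a ball, which has finite measure, almost everywhere convergence implies convergence in
measure. -/
theorem tendsto_volume_ball_inter_le {τ : ℕ → Rd d → ℝ} (hτ : ∀ j, AEMeasurable (τ j))
    (h : ∀ᵐ ξ, Tendsto (fun j => τ j ξ) atTop (𝓝 1)) (r : ℝ) {a : ℝ} (ha : a < 1) :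
    Tendsto (fun j => volume (Metric.ball (0 : Rd d) r ∩ {ξ | τ j ξ ≤ a})) atTop (𝓝 0) := by
  have : IsFiniteMeasure ((volume : Measure (Rd d)).restrict (Metric.ball 0 r)) :=
    ⟨by simpa using measure_ball_lt_top⟩
  have h1 := tendstoInMeasure_of_tendsto_ae
    (μ := (volume : Measure (Rd d)).restrict (Metric.ball 0 r)) (g := fun _ => (1 : ℝ))
    (fun j => (hτ j).aestronglyMeasurable.restrict) (ae_restrict_of_ae h)
  have h2 := h1 (ENNReal.ofReal (1 - a)) (ENNReal.ofReal_pos.mpr (by linarith))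
  refine tendsto_of_tendsto_of_tendsto_of_le_of_le tendsto_const_nhds h2
    (fun _ => zero_le) fun j => ?_
  rw [Set.inter_comm]
  refine (Measure.le_restrict_apply _ _).trans (measure_mono fun ξ hξ => ?_)
  have hξ' : τ j ξ ≤ a := hξ
  change ENNReal.ofReal (1 - a) ≤ edist (τ j ξ) 1
  rw [edist_dist, Real.dist_eq, abs_sub_comm]
  exact ENNReal.ofReal_le_ofReal ((by linarith : 1 - a ≤ 1 - τ j ξ).trans (le_abs_self _))

/-- Diagonal choice of radii: the set where `τ` is far from `1` near the origin is negligible at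
every scale. -/
theorem IsExpansiveDilation.exists_radii (hd : 0 < d) {τ : Rd d → ℝ} (hτ : Measurable τ)
    (h : ∀ᵐ ξ : Rd d, Tendsto (fun j : ℕ => τ ((hA.adjointEquiv ^ (-(j : ℤ))) ξ)) atTop (𝓝 1)) :
    ∃ ρ : ℕ → ℝ, (∀ n, 0 < ρ n) ∧ ∀ r : ℝ, Tendsto (fun j : ℕ => ∑' n : ℕ,
      volume (Metric.ball (0 : Rd d) r ∩ {ξ | (hA.adjointEquiv ^ (-(j : ℤ))) ξ ∈
        Metric.ball (0 : Rd d) (ρ n) ∧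
          τ ((hA.adjointEquiv ^ (-(j : ℤ))) ξ) ≤ 1 - 1 / ((n : ℝ) + 1)})) atTop (𝓝 0) := by
  have hδ : ∀ n : ℕ, 1 - 1 / ((n : ℝ) + 1) < 1 := fun n => by
    have : 0 < 1 / ((n : ℝ) + 1) := by positivity
    linarith
  have hsmall := fun (r : ℝ) (n : ℕ) => tendsto_volume_ball_inter_le
    (fun j : ℕ => (hτ.comp (measurable_linearEquiv (hA.adjointEquiv ^ (-(j : ℤ))))).aemeasurable)
    h r (hδ n)
  have hgeom : ∀ n : ℕ, (0 : ℝ≥0∞) < (1 / 2) ^ n := fun n =>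
    ENNReal.pow_pos (by simp) n
  -- From scale J n on, the points of the ball of radius n + 1 with small τ have measure at most
  -- 2⁻ⁿ.
  have hJ : ∀ n : ℕ, ∃ J : ℕ, ∀ j ≥ J, volume (Metric.ball (0 : Rd d) ((n : ℝ) + 1) ∩
      {ξ | τ ((hA.adjointEquiv ^ (-(j : ℤ))) ξ) ≤ 1 - 1 / ((n : ℝ) + 1)}) ≤ (1 / 2) ^ n :=
    fun n => eventually_atTop.mp ((hsmall ((n : ℝ) + 1) n).eventually_le_const (hgeom n))
  choose J hJ using hJ
  -- For the finitely many earlier scales the radius itself is taken so small that the pulled-back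
  -- ball has measure at most 2⁻ⁿ.
  have hρ : ∀ n : ℕ, ∃ ρ : ℝ, 0 < ρ ∧ ∀ j < J n,
      volume ((hA.adjointEquiv ^ (-(j : ℤ))) ⁻¹' Metric.ball (0 : Rd d) ρ) ≤ (1 / 2) ^ n := by
    intro n
    have h1 : ∀ j : ℕ, ∀ᶠ ρ : ℝ in 𝓝[>] 0,
        volume ((hA.adjointEquiv ^ (-(j : ℤ))) ⁻¹' Metric.ball (0 : Rd d) ρ) ≤ (1 / 2) ^ n := by
      intro j
      have h2 : ∀ ρ : ℝ, volume ((hA.adjointEquiv ^ (-(j : ℤ))) ⁻¹' Metric.ball (0 : Rd d) ρ) = _ :=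
        fun ρ => Measure.addHaar_preimage_linearMap volume
          (f := ((hA.adjointEquiv ^ (-(j : ℤ)) : Rd d ≃ₗ[ℝ] Rd d) : Rd d →ₗ[ℝ] Rd d))
          (hA.adjointEquiv ^ (-(j : ℤ))).isUnit_det'.ne_zero (Metric.ball 0 ρ)
      simp_rw [h2]
      have h3 := ENNReal.Tendsto.const_mul (tendsto_volume_ball_zero hd) (Or.inr
        (ENNReal.ofReal_ne_top (r := |(LinearMap.det
          ((hA.adjointEquiv ^ (-(j : ℤ)) : Rd d ≃ₗ[ℝ] Rd d) : Rd d →ₗ[ℝ] Rd d))⁻¹|)))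
      rw [mul_zero] at h3
      exact h3.eventually_le_const (hgeom n)
    have h4 : ∀ᶠ ρ : ℝ in 𝓝[>] 0, ∀ j ∈ Finset.range (J n),
        volume ((hA.adjointEquiv ^ (-(j : ℤ))) ⁻¹' Metric.ball (0 : Rd d) ρ) ≤ (1 / 2) ^ n :=
      (eventually_all_finset _).mpr fun j _ => h1 j
    obtain ⟨ρ, hρ, hρ0⟩ := (h4.and self_mem_nhdsWithin).exists
    exact ⟨ρ, hρ0, fun j hj => hρ j (Finset.mem_range.mpr hj)⟩
  choose ρ hρ0 hρ using hρ
  refine ⟨ρ, hρ0, fun r => ?_⟩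
  -- Once r ≤ n + 1 the nth term is at most 2⁻ⁿ at all scales; the finitely many remaining terms are
  -- bounded by the volume of the ball.
  refine tendsto_tsum_ennreal_of_dominated (fun n => (1 / 2) ^ n +
    if n < ⌈r⌉₊ then volume (Metric.ball (0 : Rd d) r) else 0) ?_ (fun j n => ?_) fun n => ?_
  · rw [ENNReal.tsum_add]
    refine ENNReal.add_ne_top.mpr ⟨?_, ?_⟩
    · rw [ENNReal.tsum_geometric]
      simp
    · rw [tsum_eq_sum (s := Finset.range ⌈r⌉₊) fun n hn => if_neg (by simpa using hn)]
      refine (ENNReal.sum_lt_top.mpr fun n _ => ?_).ne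
      split_ifs
      · exact measure_ball_lt_top
      · exact ENNReal.zero_lt_top
  · by_cases hn : n < ⌈r⌉₊
    · rw [if_pos hn]
      exact (measure_mono Set.inter_subset_left).trans le_add_self
    · rw [if_neg hn, add_zero]
      have hrn : r ≤ (n : ℝ) + 1 := by
        have := Nat.le_ceil r
        have h5 : (⌈r⌉₊ : ℝ) ≤ n := by exact_mod_cast not_lt.mp hn
        linarith
      by_cases hj : j < J n
      · refine (measure_mono ?_).trans (hρ n j hj)
        exact fun ξ hξ => hξ.2.1
      · refine (measure_mono ?_).trans (hJ n j (not_lt.mp hj))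
        exact fun ξ hξ => ⟨Metric.ball_subset_ball hrn hξ.1, hξ.2.2⟩
  · refine tendsto_of_tendsto_of_tendsto_of_le_of_le tendsto_const_nhds (hsmall r n)
      (fun _ => zero_le) fun j => measure_mono ?_
    exact fun ξ hξ => ⟨hξ.1, hξ.2.2⟩

theorem isApproxContinuous_of_ae_tendsto_one (hd : 0 < d) {σ : Rd d → ℝ}
    (hm : AEMeasurable σ) (hle : ∀ᵐ ξ, σ ξ ≤ 1)
    (h : ∀ᵐ ξ : Rd d, Tendsto (fun j : ℕ => σ ((hA.adjointEquiv ^ (-(j : ℤ))) ξ)) atTop (𝓝 1)) :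
    IsApproxContinuous hA.adjointEquiv (Function.update σ 0 1) := by
  set τ := hm.mk σ with hτdef
  have hτ : Measurable τ := hm.measurable_mk
  have hστ : ∀ᵐ ξ, σ ξ = τ ξ := hm.ae_eq_mk
  have hτlim : ∀ᵐ ξ : Rd d,
      Tendsto (fun j : ℕ => τ ((hA.adjointEquiv ^ (-(j : ℤ))) ξ)) atTop (𝓝 1) := by
    have h1 : ∀ᵐ ξ : Rd d, ∀ j : ℕ, σ ((hA.adjointEquiv ^ (-(j : ℤ))) ξ) =
        τ ((hA.adjointEquiv ^ (-(j : ℤ))) ξ) :=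
      ae_all_iff.mpr fun j => (quasiMeasurePreserving_equiv _).ae hστ
    filter_upwards [h, h1] with ξ h2 h3
    exact h2.congr h3
  obtain ⟨ρ, hρ0, hρ⟩ := hA.exists_radii hd hτ hτlim
  -- The limit along S is a statement about every point of S, so almost everywhere relations must
  -- first be made exact on a measurable set of full measure.
  obtain ⟨G, hGsub, hGm, hGae⟩ : ∃ G ⊆ {ξ | σ ξ = τ ξ ∧ σ ξ ≤ 1}, MeasurableSet G ∧
      ∀ᵐ ξ, ξ ∈ G := by
    obtain ⟨N, hN1, hN2, hN3⟩ := exists_measurable_superset_of_null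
      (show volume {ξ | ¬(σ ξ = τ ξ ∧ σ ξ ≤ 1)} = 0 from hστ.and hle)
    refine ⟨Nᶜ, fun ξ hξ => ?_, hN2.compl, measure_eq_zero_iff_ae_notMem.mp hN3⟩
    by_contra hcon
    exact hξ (hN1 hcon)
  -- Inside the ball of radius ρ n, membership in S forces τ > 1 - 1/(n+1), which yields the limit
  -- at 0. What S omits at scale j is covered, up to a null set, by the sets summed in
  -- `exists_radii`.
  set S : Set (Rd d) := G ∩ ⋂ n : ℕ,
    ({ξ | 1 - 1 / ((n : ℝ) + 1) < τ ξ} ∪ (Metric.ball (0 : Rd d) (ρ n))ᶜ) with hS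
  have hSm : MeasurableSet S := hGm.inter (MeasurableSet.iInter fun n =>
    (measurableSet_lt measurable_const hτ).union Metric.isOpen_ball.measurableSet.compl)
  have hdens : IsPointOfDensity hA.adjointEquiv S := by
    intro r hr
    simp_rw [measureReal_inter_image_div]
    have hbad : Tendsto (fun j : ℕ => volume (Metric.ball (0 : Rd d) r \
        (hA.adjointEquiv ^ (-(j : ℤ))) ⁻¹' S)) atTop (𝓝 0) := by
      refine tendsto_of_tendsto_of_tendsto_of_le_of_le tendsto_const_nhds (hρ r)
        (fun _ => zero_le) fun j => ?_
      refine le_trans ?_ (measure_iUnion_le _)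
      refine measure_mono_ae ?_
      filter_upwards [(quasiMeasurePreserving_equiv (hA.adjointEquiv ^ (-(j : ℤ)))).ae hGae]
        with ξ hξG hξ
      have hξS : (hA.adjointEquiv ^ (-(j : ℤ))) ξ ∉ S := hξ.2
      simp only [hS, Set.mem_inter_iff, hξG, true_and, Set.mem_iInter, not_forall] at hξS
      obtain ⟨n, hn⟩ := hξS
      rw [Set.mem_union, not_or, Set.notMem_compl_iff] at hn
      exact Set.mem_iUnion.mpr ⟨n, hξ.1, hn.2, not_lt.mp hn.1⟩
    have hbad' := (ENNReal.tendsto_toReal ENNReal.zero_ne_top).comp hbad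
    have hr0 := (measureReal_ball_pos (d := d) hr).ne'
    have h2 := (hbad'.div_const (volume.real (Metric.ball (0 : Rd d) r))).const_sub 1
    simp only [ENNReal.toReal_zero, zero_div, sub_zero] at h2
    refine h2.congr fun j => ?_
    have h3 := measureReal_inter_add_sdiff (μ := volume) (s := Metric.ball (0 : Rd d) r)
      (measurable_linearEquiv (hA.adjointEquiv ^ (-(j : ℤ))) hSm) measure_ball_lt_top.ne
    change 1 - volume.real (Metric.ball (0 : Rd d) r \
      (hA.adjointEquiv ^ (-(j : ℤ))) ⁻¹' S) / _ = _
    rw [eq_div_iff hr0, sub_mul, div_mul_cancel₀ _ hr0, one_mul]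
    linarith
  refine ⟨S, hSm, ?_, hdens, ?_⟩
  -- A null set would have density 0, not 1.
  · rw [pos_iff_ne_zero]
    intro h0
    have h1 := hdens 1 one_pos
    have h2 : ∀ K : Set (Rd d), volume.real (S ∩ K) = 0 := fun K => by
      rw [measureReal_def, measure_mono_null Set.inter_subset_left h0, ENNReal.toReal_zero]
    simp_rw [h2, zero_div] at h1
    exact zero_ne_one (tendsto_nhds_unique tendsto_const_nhds h1)
  · rw [Function.update_self, Metric.tendsto_nhdsWithin_nhds]
    intro ε hε
    obtain ⟨n, hn⟩ := exists_nat_one_div_lt hε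
    refine ⟨ρ n, hρ0 n, fun x hxS hx => ?_⟩
    by_cases hx0 : x = 0
    · rw [hx0, Function.update_self, dist_self]
      exact hε
    · rw [Function.update_of_ne hx0]
      obtain ⟨h1, h2⟩ := hGsub hxS.1
      have h3 := (Set.mem_iInter.mp hxS.2 n).resolve_right fun hc => hc hx
      have h4 : 1 - 1 / ((n : ℝ) + 1) < τ x := h3
      rw [Real.dist_eq, abs_sub_lt_iff]
      constructor <;> linarith

end

end SpectralCompleteness

end

/-! ### The equivalences -/

open SpectralCompleteness in
theorem mainTheorem2 {d : ℕ} (hd : 0 < d)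
    (A : Rd d →ₗ[ℝ] Rd d) (hA : IsExpansiveDilation A)
    (V : Submodule ℂ (L2 d)) (hV : IsShiftInvariant V) (hAV : IsRefinable hA.equiv V) :
    (∃ σ : Rd d → ℝ, IsSpectralFunction V σ) ∧
    ∀ σ : Rd d → ℝ, IsSpectralFunction V σ →
      List.TFAE [
        HasCompletenessProperty hA.equiv V,
        ∀ 𝒢 : Set (L2 d), Generates 𝒢 V →
          ∀ᵐ ξ : Rd d, ξ ∈ dilatedFourierSupports hA.adjointEquiv 𝒢,
        ∃ 𝒢 : Set (L2 d), 𝒢.Countable ∧ Generates 𝒢 V ∧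
          ∀ᵐ ξ : Rd d, ξ ∈ dilatedFourierSupports hA.adjointEquiv 𝒢,
        ∀ E : Set (Rd d), MeasurableSet E → Bornology.IsBounded E → 0 < volume E →
          Tendsto (fun j : ℕ =>
            (volume.real ((hA.adjointEquiv ^ (-(j : ℤ))) '' E))⁻¹ *
              ∫ ξ in (hA.adjointEquiv ^ (-(j : ℤ))) '' E, σ ξ) atTop (𝓝 1),
        IsAbsorbing hA.adjointEquiv⁻¹ (Function.support σ),
        ∀ᵐ ξ : Rd d, ∃ L : ℝ, 0 < L ∧
          Tendsto (fun j : ℕ => σ ((hA.adjointEquiv ^ (-(j : ℤ))) ξ)) atTop (𝓝 L),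
        ∀ᵐ ξ : Rd d,
          Tendsto (fun j : ℕ => σ ((hA.adjointEquiv ^ (-(j : ℤ))) ξ)) atTop (𝓝 1),
        IsLocallyNonzero hA.adjointEquiv σ,
        IsApproxContinuous hA.adjointEquiv (Function.update σ 0 1)] := by
  have : CompleteSpace V := hV.isClosed.completeSpace_coe
  refine ⟨exists_isSpectralFunction hV, fun σ hσ => ?_⟩
  -- The support condition takes two entries of the list, one for every generating set (2) and one
  -- for some countable set (3), so the later conditions are shifted by one. The main cycle is 1, 4,
  -- 7, 6, 5, 2, 3, 1; the conditions at the origin branch off at 7 and rejoin at 2.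
  tfae_have 1 → 4 := fun h E hE hb hpos => h.tendsto_average hA hd hV hAV hσ hE hb hpos
  tfae_have 4 → 7 := hσ.ae_tendsto_one hA hV hAV
  tfae_have 7 → 6 := fun h => h.mono fun ξ hξ => ⟨1, one_pos, hξ⟩
  tfae_have 6 → 5 := isAbsorbing_of_ae_tendsto_pos hA
  tfae_have 5 → 2 := by
    intro h 𝒢 hg
    refine hσ.ae_mem_dilatedFourierSupports hA hV (h.mono fun ξ ⟨j, hj⟩ => ⟨j, ?_⟩) hg
    have h1 := hj j le_rfl
    rwa [inv_pow, ← zpow_natCast, ← zpow_neg] at h1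
  tfae_have 2 → 3 := by
    intro h
    obtain ⟨𝒢, hc, hg⟩ := hV.exists_countable_generates
    exact ⟨𝒢, hc, hg, h 𝒢 hg⟩
  tfae_have 3 → 1 := fun ⟨𝒢, hc, hg, h⟩ =>
    hasCompletenessProperty_of_ae_mem_dilatedFourierSupports hA hd hV hAV hc hg h
  tfae_have 7 → 9 := isApproxContinuous_of_ae_tendsto_one hA hd (hσ.aemeasurable hV)
    (hσ.ae_le_one hV)
  tfae_have 9 → 8 := fun h => h.isLocallyNonzero hA hd
  tfae_have 8 → 2 := fun h 𝒢 hg =>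
    hσ.ae_mem_dilatedFourierSupports hA hV (h.ae_exists_ne_zero hA hd) hg
  tfae_finish
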